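/- Let $(F_1,J)$ be a site with finite products and $L_2,\dots,L_n$ sheaves of abelian groups on it. An abelian tower of torsors with bands $L_2,\dots,L_n$ is a sequence of functors $F_n\to F_{n-1}\to\dots\to F_2\to F_1$ such that: $F_2\to F_1$ is a gerbe; each $F_{i+1}\to F_i$ ($i\ge 2$) is a fibred category; the arrows of $F_i$ ($i\ge2$) that project to an identity of $F_{i-1}$ are invertible; for every object $x$ of $F_i$ over $U\in F_1$ the group of automorphisms of $x$ projecting to the identity in $F_{i-1}$ is identified with $L_i(U)$, compatibly with all arrows of $F_i$; for $i\ge 3$ the automorphisms of $x$ projecting to the identity in $F_{i-2}$ are in the same way identified with the sections over $U$ of a sheaf of abelian groups $L'_i$ on $F_1$; every object of $F_1$ has a covering family by objects $V$ that are connected (two objects of the same $F_i$ over $V$ are isomorphic by an isomorphism projecting to the identity of $V$, and by one projecting to the identity of $F_c$ whenever the two objects have the same image in $F_c$, $c<i$), and a covering family over which all the $F_i$ are non-empty. Let $X=(X_i)_{i\in I}$ be a family covering the final object of $F_1$ such that all the products $X_{i_0\dots i_k}=X_{i_0}\times\dots\times X_{i_k}$ are connected for the tower. Classifying cochains $c_2,\dots,c_n$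 of the tower with respect to $X$ are obtained as follows. Choose objects $x_i$ of $F_2$ over $X_i$ and arrows $g_{ij}:x_j|_{X_{ij}}\to x_i|_{X_{ij}}$ over the identity, and define $c_2=(c_{ijk})$, $c_{ijk}\in L_2(X_{ijk})$, by $g_{ij}g_{jk}=c_{ijk}g_{ik}$; put $x_{ijk}=x_k|_{X_{ijk}}$. Given $c_l$ and the objects $x_{i_1\dots i_{l+1}}$ of $F_l$ over $X_{i_1\dots i_{l+1}}$, choose objects $x_{i_1\dots i_{l+2}}$ of $F_{l+1}$ over restrictions of $x_{i_1\dots i_{l+1}}$ to $X_{i_1\dots i_{l+2}}$, and a cochain $c_l^*$ with values in $L'_{l+1}$ whose action on these objects lifts the action of $c_l$; then $c_{l+1}$ is the $L_{l+1}$-valued cochain whose action on $x_{i_1\dots i_{l+2}}$ is that of $\sum_{r}(-1)^{r}(c^*_l)_{i_1\dots\hat{\imath}_{r+1}\dots i_{l+2}}$ ($r=0,\dots,l+1$). An isomorphism between two such towers $F_\bullet,F'_\bullet$ with the same $F_1$ and the same bands consists of functors $u_i:F_i\to F'_i$, $i=1,\dots,n$, commuting with the functors of the towers and with the actions of the bands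 (for $u_1$, which is a continuous functor $F_1\to F_1$, an identification $L_i\simeq u_1^*L_i$ is part of the data), and of functors $v_i:F'_i\to F_i$ with the same properties, with isomorphisms $v_iu_i\simeq \mathrm{Id}$ and $u_iv_i\simeq\mathrm{Id}$ such that the isomorphism at each level lies over the one at the level below. Proposition. Let $u:F_\bullet\to F'_\bullet$ be an isomorphism of abelian towers of torsors with the same $F_1$ and the same bands $L_2,\dots,L_n$. Let $c_2,\dots,c_n$ be classifying cochains of $F_\bullet$ with respect to a family $X=(X_i)$, and $c'_2,\dots,c'_n$ classifying cochains of $F'_\bullet$ with respect to the family $u_1(X)=(u_1(X_i))$, for any choices made in their construction. Then for $2\le l\le n$ the cochains $c_l$ and $c'_l$ are Čech cocycles, and their classes coincide: $[c_l]=u_1^*[c'_l]$ in $\check H^l(X,L_l)$, where $u_1^*:\check H^l(u_1(X),L_l)\to\check H^l(X,L_l)$ is the map induced by $u_1$ and the identification of the bands. In particular $[c_l]=[c'_l]$ if $u_1$ is the identity and the identification of the bands is the identity. -/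

import Mathlib

open CategoryTheory CategoryTheory.Limits Opposite

set_option linter.checkUnivs false

universe w v u v₂ u₂ t

noncomputable section

namespace TorsorTower

/-! ### Sheaves of categories and gerbes -/

section Gerbes

variable {C : Type u} [Category.{v} C] {X : Type u₂} [Category.{v₂} X]

/-- A cartesian functor over `C` from `q : D ⥤ C` to `p : X ⥤ C`. It is used when every arrow of
`D` is `q`-cartesian (slices `C / U` and their sieves), so every arrow goes to a cartesian one. -/
structure CartFunctor {D : Type*} [Category* D] (p : X ⥤ C) (q : D ⥤ C) where
  /-- the underlying functor -/
  functor : D ⥤ X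
  w : functor ⋙ p = q
  cart : ∀ {a b : D} (f : a ⟶ b), p.IsCartesian (q.map f) (functor.map f)

/-- Morphisms of cartesian functors over `C`: natural transformations lying over identities. -/
@[ext]
structure CartFunctor.Hom {D : Type*} [Category* D] {p : X ⥤ C} {q : D ⥤ C}
    (s t : CartFunctor p q) where
  /-- the underlying natural transformation -/
  natTrans : s.functor ⟶ t.functor
  lift_id : ∀ a : D, p.IsHomLift (𝟙 (q.obj a)) (natTrans.app a)

instance {D : Type*} [Category* D] (p : X ⥤ C) (q : D ⥤ C) : Category (CartFunctor p q) where
  Hom s t := CartFunctor.Hom s t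
  id s := ⟨𝟙 s.functor, fun a => IsHomLift.id (Functor.congr_obj s.w a)⟩
  comp α β := ⟨α.natTrans ≫ β.natTrans, fun a => by
    have := α.lift_id a
    have := β.lift_id a
    exact IsHomLift.comp_of_lift_id p (q.obj a) (α.natTrans.app a) (β.natTrans.app a)⟩
  id_comp _ := CartFunctor.Hom.ext (Category.id_comp _)
  comp_id _ := CartFunctor.Hom.ext (Category.comp_id _)
  assoc _ _ _ := CartFunctor.Hom.ext (Category.assoc _ _ _)

/-- Restriction of cartesian functors along `r : D' ⥤ D`. -/
def CartFunctor.restrict {D D' : Type*} [Category* D] [Category* D'] (p : X ⥤ C) (q : D ⥤ C)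
    (r : D' ⥤ D) : CartFunctor p q ⥤ CartFunctor p (r ⋙ q) where
  obj s := ⟨r ⋙ s.functor, by rw [Functor.assoc, s.w], fun f => s.cart (r.map f)⟩
  map α := ⟨Functor.whiskerLeft r α.natTrans, fun a => α.lift_id (r.obj a)⟩

/-- `p : X ⥤ C` is a sheaf of categories (a stack) on `(C, J)`: it is a fibred category and for
every covering sieve `S` of `U` the restriction `Cart_C(C/U, X) ⥤ Cart_C(S, X)` is an
equivalence of categories. -/
structure IsSheafOfCategories (J : GrothendieckTopology C) (p : X ⥤ C) : Prop where
  fibered : p.IsFibered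
  descent : ∀ (U : C) (S : Sieve U), S ∈ J U →
    (CartFunctor.restrict p (Over.forget U)
      (ObjectProperty.ι (fun f : Over U => S.arrows f.hom))).IsEquivalence

/-- `p : X ⥤ C` is a gerbe on `(C, J)`: a sheaf of categories whose fibres are groupoids, locally
non-empty, and in which two objects over the same base are locally isomorphic. -/
structure IsGerbe (J : GrothendieckTopology C) (p : X ⥤ C) : Prop
    extends IsSheafOfCategories J p where
  isIso : ∀ {x y : X} (φ : x ⟶ y), p.IsHomLift (𝟙 (p.obj x)) φ → IsIso φ
  locally_nonempty : ∀ U : C, ∃ S ∈ J U, ∀ (V : C) (f : V ⟶ U), S f → ∃ x : X, p.obj x = V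
  locally_isomorphic : ∀ (U : C) (x y : X), p.obj x = U → p.obj y = U →
    ∃ S ∈ J U, ∀ (V : C) (f : V ⟶ U), S f →
      ∃ (x' y' : X) (α : x' ⟶ x) (β : y' ⟶ y) (e : x' ≅ y'),
        p.IsCartesian f α ∧ p.IsCartesian f β ∧ p.IsHomLift (𝟙 V) e.hom

end Gerbes

/-! ### Towers of torsors

The levels `F₂, F₃, …` of a tower `Fₙ → … → F₂ → F₁ = C` are `F 0, F 1, …`, that is, `F j` is the
level `F_{j+2}` and the band `L_{j+2}` is `L j`. Only the indices with `j + 2 ≤ n` matter. -/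

/-- A sequence of functors `… → F₃ → F₂ → C`. -/
structure PreTower (C : Type u) [Category.{v} C] where
  /-- the levels -/
  F : ℕ → Type u₂
  /-- the levels are categories -/
  cat : ∀ j, Category.{v₂} (F j)
  /-- the functor `F₂ → F₁ = C` -/
  p₂ : F 0 ⥤ C
  /-- the functors `F_{j+3} → F_{j+2}` -/
  p : ∀ j, F (j + 1) ⥤ F j

attribute [instance] PreTower.cat

namespace PreTower

variable {C : Type u} [Category.{v} C] (T : PreTower.{v, u, v₂, u₂} C)

/-- The composite functor from a level to the base `C`. -/
def π : ∀ j, T.F j ⥤ C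
  | 0 => T.p₂
  | j + 1 => T.p j ⋙ π j

/-- The composite functor that goes down `k` levels. -/
def down (j : ℕ) : ∀ k, T.F (j + k) ⥤ T.F j
  | 0 => 𝟭 _
  | k + 1 => T.p (j + k) ⋙ down j k

/-- An arrow of a level is vertical if it projects to the identity one level below. -/
def IsVertical : ∀ {j : ℕ} {x y : T.F j}, (x ⟶ y) → Prop
  | 0, x, _, f => T.p₂.IsHomLift (𝟙 (T.p₂.obj x)) f
  | j + 1, x, _, f => (T.p j).IsHomLift (𝟙 ((T.p j).obj x)) f

/-- `V` is a connected object of the base for the first `n` levels of the tower: two objects over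
`V` of the same level are isomorphic, by an isomorphism that projects to the identity of `V`, and
by one that projects to the identity of their image in any lower level where they have the same
image. -/
structure IsConnected (n : ℕ) (V : C) : Prop where
  base : ∀ j, j + 2 ≤ n → ∀ x y : T.F j, (T.π j).obj x = V → (T.π j).obj y = V →
    ∃ e : x ≅ y, (T.π j).IsHomLift (𝟙 V) e.hom
  level : ∀ j k, j + k + 2 ≤ n → ∀ x y : T.F (j + k),
    (T.π (j + k)).obj x = V → (T.π (j + k)).obj y = V →
    (T.down j k).obj x = (T.down j k).obj y →
    ∃ e : x ≅ y, (T.down j k).IsHomLift (𝟙 ((T.down j k).obj x)) e.hom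

end PreTower

/-- An abelian tower of torsors `Fₙ → … → F₂ → F₁ = C` with bands `L₂, …, Lₙ`, which are sheaves of
abelian groups on the site `(C, J)`.

Restriction along arrows of `C` is given by cartesian arrows. -/
structure AbelianTower {C : Type u} [Category.{v} C] (J : GrothendieckTopology C)
    (L : ℕ → Sheaf J AddCommGrpCat.{w}) (n : ℕ) extends PreTower.{v, u, v₂, u₂} C where
  /-- `F₂ → F₁` is a gerbe (its band `L₂` is given by `act` below). -/
  gerbe : 2 ≤ n → IsGerbe J p₂
  /-- Arrows that project to an identity one level below are invertible. -/
  isIso_of_isVertical : ∀ j, j + 2 ≤ n → ∀ {x y : F j} (f : x ⟶ y),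
    toPreTower.IsVertical f → IsIso f
  /-- Arrows of a level lift to cartesian arrows of the next one, and cartesian arrows compose. -/
  fibered : ∀ j, j + 3 ≤ n → (p j).IsFibered
  /-- The action of the band on the objects of a level. -/
  act : ∀ j (x : F j), (L j).obj.obj (op ((toPreTower.π j).obj x)) →+ Additive (Aut x)
  /-- The action identifies the sections of the band over the projection of `x` to `C` with the
  automorphisms of `x` that project to the identity one level below. -/
  act_injective : ∀ j, j + 2 ≤ n → ∀ x : F j, Function.Injective (act j x)
  act_range : ∀ j, j + 2 ≤ n → ∀ (x : F j) (f : Aut x),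
    (∃ a, (act j x a).toMul = f) ↔ toPreTower.IsVertical f.hom
  /-- The action commutes with the arrows of the level and with restriction. -/
  act_natural : ∀ j, j + 2 ≤ n → ∀ {x y : F j} (φ : x ⟶ y)
    (a : (L j).obj.obj (op ((toPreTower.π j).obj y))),
    (act j x ((L j).obj.map ((toPreTower.π j).map φ).op a)).toMul.hom ≫ φ =
      φ ≫ (act j y a).toMul.hom
  /-- The sheaves of abelian groups of the automorphisms that project to the identity two levels
  below. -/
  L' : ℕ → Sheaf J AddCommGrpCat.{w}
  /-- Their action on the objects of `F_{j+3}`. -/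
  act' : ∀ j (x : F (j + 1)),
    (L' j).obj.obj (op ((toPreTower.π (j + 1)).obj x)) →+ Additive (Aut x)
  act'_injective : ∀ j, j + 3 ≤ n → ∀ x : F (j + 1), Function.Injective (act' j x)
  act'_range : ∀ j, j + 3 ≤ n → ∀ (x : F (j + 1)) (f : Aut x),
    (∃ a, (act' j x a).toMul = f) ↔ toPreTower.IsVertical ((p j).map f.hom)
  act'_natural : ∀ j, j + 3 ≤ n → ∀ {x y : F (j + 1)} (φ : x ⟶ y)
    (a : (L' j).obj.obj (op ((toPreTower.π (j + 1)).obj y))),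
    (act' j x ((L' j).obj.map ((toPreTower.π (j + 1)).map φ).op a)).toMul.hom ≫ φ =
      φ ≫ (act' j y a).toMul.hom
  /-- Every object of `C` has a covering family by connected objects. -/
  locally_connected : ∀ U : C, ∃ R : Presieve U, Sieve.generate R ∈ J U ∧
    ∀ (V : C) (f : V ⟶ U), R f → toPreTower.IsConnected n V
  /-- Every object of `C` has a covering family over which all the levels are non-empty. -/
  locally_nonempty : ∀ U : C, ∃ R : Presieve U, Sieve.generate R ∈ J U ∧
    ∀ (V : C) (f : V ⟶ U), R f → ∀ j, j + 2 ≤ n → ∃ x : F j, (toPreTower.π j).obj x = V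

namespace AbelianTower

variable {C : Type u} [Category.{v} C] {J : GrothendieckTopology C}
  {L : ℕ → Sheaf J AddCommGrpCat.{w}} {n : ℕ} (T : AbelianTower.{w, v, u, v₂, u₂} J L n)

/-- The automorphism of an object `x` over `U` given by a section of the band over `U`. -/
def actOn (j : ℕ) {U : C} (x : T.F j) (hx : (T.π j).obj x = U) (a : (L j).obj.obj (op U)) :
    x ⟶ x :=
  (T.act j x ((L j).obj.map (eqToHom hx).op a)).toMul.hom

/-- The automorphism of an object `x` over `U` given by a section of `L'` over `U`. -/
def actOn' (j : ℕ) {U : C} (x : T.F (j + 1)) (hx : (T.π (j + 1)).obj x = U)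
    (a : (T.L' j).obj.obj (op U)) : x ⟶ x :=
  (T.act' j x ((T.L' j).obj.map (eqToHom hx).op a)).toMul.hom

end AbelianTower

/-! ### Morphisms and isomorphisms of towers -/

/-- A continuous functor from the site `(C, J)` to itself with an identification of the bands. -/
structure BaseMap {C : Type u} [Category.{v} C] (J : GrothendieckTopology C)
    (L : ℕ → Sheaf J AddCommGrpCat.{w}) where
  /-- the functor `u₁ : F₁ → F₁` -/
  functor : C ⥤ C
  continuous : functor.IsContinuous J J
  /-- the identification of the bands -/
  band : ∀ j, (L j).obj ≅ functor.op ⋙ (L j).obj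

/-- The identity base map. -/
def BaseMap.refl {C : Type u} [Category.{v} C] (J : GrothendieckTopology C)
    (L : ℕ → Sheaf J AddCommGrpCat.{w}) : BaseMap J L where
  functor := 𝟭 C
  continuous := ⟨fun G => (isSheaf_iff_isSheaf_of_type J G.obj).1 G.property⟩
  band j := Iso.refl (L j).obj

/-- A morphism of towers with the same base and the same bands: functors `u₁, …, uₙ` between the
levels, `u₁` continuous, that commute with the functors of the towers and with the action of the
bands. -/
structure TowerHom {C : Type u} [Category.{v} C] {J : GrothendieckTopology C}
    {L : ℕ → Sheaf J AddCommGrpCat.{w}} {n : ℕ} (T T' : AbelianTower.{w, v, u, v₂, u₂} J L n) where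
  /-- the functor `u₁` -/
  base : BaseMap J L
  /-- the functors `u₂, …, uₙ` -/
  u : ∀ j, j + 2 ≤ n → (T.F j ⥤ T'.F j)
  comm₂ : ∀ h : 0 + 2 ≤ n, u 0 h ⋙ T'.p₂ = T.p₂ ⋙ base.functor
  comm : ∀ j (h : j + 1 + 2 ≤ n) (h' : j + 2 ≤ n), u (j + 1) h ⋙ T'.p j = T.p j ⋙ u j h'
  /-- (this is a consequence of the two previous conditions) -/
  comm_base : ∀ j (h : j + 2 ≤ n), u j h ⋙ T'.π j = T.π j ⋙ base.functor
  map_act : ∀ j (h : j + 2 ≤ n) (x : T.F j) (a : (L j).obj.obj (op ((T.π j).obj x))),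
    (u j h).map (T.act j x a).toMul.hom =
      T'.actOn j ((u j h).obj x) (Functor.congr_obj (comm_base j h) x)
        ((base.band j).hom.app (op ((T.π j).obj x)) a)

/-- An isomorphism of towers: a morphism with a morphism in the other direction such that the
composites are isomorphic to the identities at all levels, by isomorphisms of fibred categories,
i.e. the isomorphism at a level lies over the one at the level below. (Such isomorphisms commute
with the action of the bands because this action commutes with all arrows.) -/
structure TowerIso {C : Type u} [Category.{v} C] {J : GrothendieckTopology C}
    {L : ℕ → Sheaf J AddCommGrpCat.{w}} {n : ℕ} (T T' : AbelianTower.{w, v, u, v₂, u₂} J L n) where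
  /-- the functors `u_i` -/
  hom : TowerHom T T'
  /-- the functors `v_i` -/
  inv : TowerHom T' T
  /-- `v₁ u₁ ≅ Id` -/
  unit₁ : hom.base.functor ⋙ inv.base.functor ≅ 𝟭 C
  /-- `u₁ v₁ ≅ Id` -/
  counit₁ : inv.base.functor ⋙ hom.base.functor ≅ 𝟭 C
  /-- `v_i u_i ≅ Id` -/
  unit : ∀ j h, hom.u j h ⋙ inv.u j h ≅ 𝟭 (T.F j)
  /-- `u_i v_i ≅ Id` -/
  counit : ∀ j h, inv.u j h ⋙ hom.u j h ≅ 𝟭 (T'.F j)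
  unit_over₂ : ∀ h x, T.p₂.IsHomLift (unit₁.hom.app (T.p₂.obj x)) ((unit 0 h).hom.app x)
  unit_over : ∀ j h h' x,
    (T.p j).IsHomLift ((unit j h').hom.app ((T.p j).obj x)) ((unit (j + 1) h).hom.app x)
  counit_over₂ : ∀ h x, T'.p₂.IsHomLift (counit₁.hom.app (T'.p₂.obj x)) ((counit 0 h).hom.app x)
  counit_over : ∀ j h h' x,
    (T'.p j).IsHomLift ((counit j h').hom.app ((T'.p j).obj x)) ((counit (j + 1) h).hom.app x)

/-! ### Čech cohomology of a family of objects -/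

section Cech

variable {C : Type u} [Category.{v} C] [HasFiniteProducts C] {ι : Type t}

/-- `X_{i₀ … i_k}`: the product of the `X_{i_r}`, i.e. their fibre product over the final object. -/
abbrev cap (X : ι → C) {k : ℕ} (I : Fin k → ι) : C := ∏ᶜ fun r => X (I r)

/-- The projection `X_I → X_{I ∘ e}`. -/
def capMap (X : ι → C) {k l : ℕ} (I : Fin k → ι) (e : Fin l → Fin k) : cap X I ⟶ cap X (I ∘ e) :=
  Pi.lift fun s => Pi.π (fun r => X (I r)) (e s)

/-- Čech `k`-cochains with values in `G`. -/
abbrev CechCochain (G : Cᵒᵖ ⥤ AddCommGrpCat.{w}) (X : ι → C) (k : ℕ) : Type (max t w) :=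
  ∀ I : Fin (k + 1) → ι, G.obj (op (cap X I))

/-- The Čech differential. -/
def cechD (G : Cᵒᵖ ⥤ AddCommGrpCat.{w}) (X : ι → C) (k : ℕ) :
    CechCochain G X k →+ CechCochain G X (k + 1) where
  toFun c I := ∑ r : Fin (k + 2), (-1 : ℤ) ^ (r : ℕ) •
    G.map (capMap X I r.succAbove).op (c (I ∘ r.succAbove))
  map_zero' := by funext I; simp
  map_add' c c' := by funext I; simp [Finset.sum_add_distrib]

/-- The Čech cohomology group `H^{k+1}` of the family `X` with values in `G`: cocycles modulo
coboundaries. -/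
abbrev CechHSucc (G : Cᵒᵖ ⥤ AddCommGrpCat.{w}) (X : ι → C) (k : ℕ) : Type (max t w) :=
  (cechD G X (k + 1)).ker ⧸ (cechD G X k).range.addSubgroupOf (cechD G X (k + 1)).ker

/-- The cohomology class of a cocycle. -/
def cechClass (G : Cᵒᵖ ⥤ AddCommGrpCat.{w}) (X : ι → C) (k : ℕ) (c : CechCochain G X (k + 1))
    (hc : cechD G X (k + 1) c = 0) : CechHSucc G X k :=
  QuotientAddGroup.mk ⟨c, hc⟩

end Cech

namespace BaseMap

variable {C : Type u} [Category.{v} C] [HasFiniteProducts C] {J : GrothendieckTopology C}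
  {L : ℕ → Sheaf J AddCommGrpCat.{w}} {ι : Type t} (b : BaseMap J L)

/-- The pull-back of cochains by `u₁`, from the family `u₁(X_i)` to the family `X_i`; the values in
the bands are compared by the identification of the bands. -/
def cochainMap (j : ℕ) (X : ι → C) (k : ℕ) :
    CechCochain (L j).obj (fun i => b.functor.obj (X i)) k →+ CechCochain (L j).obj X k where
  toFun c I := (b.band j).inv.app (op (cap X I))
    ((L j).obj.map (piComparison b.functor fun r => X (I r)).op (c I))
  map_zero' := by funext I; simp
  map_add' c c' := by funext I; simp

theorem cechD_cochainMap (j : ℕ) (X : ι → C) (k : ℕ)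
    (c : CechCochain (L j).obj (fun i => b.functor.obj (X i)) k) :
    cechD (L j).obj X k (b.cochainMap j X k c) =
      b.cochainMap j X (k + 1) (cechD (L j).obj (fun i => b.functor.obj (X i)) k c) := by
  funext I
  have key : ∀ r : Fin (k + 2),
      (L j).obj.map (capMap X I r.succAbove).op (b.cochainMap j X k c (I ∘ r.succAbove)) =
        (b.band j).inv.app (op (cap X I)) ((L j).obj.map (piComparison b.functor fun r => X (I r)).op
          ((L j).obj.map (capMap (fun i => b.functor.obj (X i)) I r.succAbove).op
            (c (I ∘ r.succAbove)))) := by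
    intro r
    have hcomp : b.functor.map (capMap X I r.succAbove) ≫
        piComparison b.functor (fun s => X ((I ∘ r.succAbove) s)) =
        piComparison b.functor (fun r => X (I r)) ≫
          capMap (fun i => b.functor.obj (X i)) I r.succAbove := by
      apply Pi.hom_ext
      intro s
      simp [capMap]
    have hnat := (b.band j).inv.naturality (capMap X I r.succAbove).op
    have h1 := congrArg (fun m => (L j).obj.map m.op (c (I ∘ r.succAbove))) hcomp
    have h2 := ConcreteCategory.congr_hom hnat
      ((L j).obj.map (piComparison b.functor fun s => X ((I ∘ r.succAbove) s)).op
        (c (I ∘ r.succAbove)))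
    simp only [op_comp, Functor.map_comp, ConcreteCategory.comp_apply] at h1
    rw [← h1]
    exact h2.symm
  simp only [cechD, AddMonoidHom.coe_mk, ZeroHom.coe_mk, key]
  simp only [cochainMap, AddMonoidHom.coe_mk, ZeroHom.coe_mk, map_sum, map_zsmul]

/-- The map induced by `u₁` on Čech cohomology, `H^{k+1}(u₁(X), L_{j+2}) → H^{k+1}(X, L_{j+2})`. -/
def cechMap (j : ℕ) (X : ι → C) (k : ℕ) :
    CechHSucc (L j).obj (fun i => b.functor.obj (X i)) k →+ CechHSucc (L j).obj X k :=
  QuotientAddGroup.map _ _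
    (((b.cochainMap j X (k + 1)).comp (AddSubgroup.subtype _)).codRestrict _ fun c => by
      have hc : cechD (L j).obj (fun i => b.functor.obj (X i)) (k + 1) c = 0 := c.2
      rw [AddMonoidHom.mem_ker, AddMonoidHom.comp_apply, AddSubgroup.coe_subtype,
        cechD_cochainMap, hc, map_zero])
    (by
      rintro ⟨c, hc⟩ ⟨e, he⟩
      exact ⟨b.cochainMap j X k e, by rw [cechD_cochainMap]; exact congrArg _ he⟩)

/-- For `u₁ = Id` and the identical identification of the bands, the induced map on Čech cohomology
is the identity. -/
theorem cechMap_refl (j : ℕ) (X : ι → C) (k : ℕ) (a : CechHSucc (L j).obj X k) :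
    (BaseMap.refl J L).cechMap j X k a = a := by
  obtain ⟨⟨c, hc⟩, rfl⟩ := QuotientAddGroup.mk_surjective a
  refine congrArg QuotientAddGroup.mk (Subtype.ext ?_)
  funext I
  have h : piComparison (𝟭 C) (fun r => X (I r)) = 𝟙 (cap X I) := by
    apply Pi.hom_ext
    intro s
    rw [piComparison_comp_π]
    exact (Category.id_comp _).symm
  change (L j).obj.map (piComparison (𝟭 C) (fun r => X (I r))).op (c I) = c I
  rw [h]
  exact ConcreteCategory.congr_hom ((L j).obj.map_id _) (c I)

end BaseMap

/-! ### The classifying cochains of an abelian tower -/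

namespace AbelianTower

variable {C : Type u} [Category.{v} C] [HasFiniteProducts C] {J : GrothendieckTopology C}
  {L : ℕ → Sheaf J AddCommGrpCat.{w}} {n : ℕ} {ι : Type t}

/-- The families used to construct the cocycles: a family `X_i` that covers the final object and
such that all the `X_{i₀ … i_k}` are connected for the tower. -/
structure IsGoodCover (T : AbelianTower.{w, v, u, v₂, u₂} J L n) (X : ι → C) : Prop where
  covers : Sieve.ofArrows X (fun i => terminal.from (X i)) ∈ J (⊤_ C)
  connected : ∀ (k : ℕ) (I : Fin (k + 1) → ι), T.IsConnected n (cap X I)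

/-- The choices made in the construction of classifying cochains `c₂, c₃, …` (here `c 0, c 1, …`,
with `c j` a `(j+2)`-cochain with values in `L_{j+2}`) of a tower with respect to a family `X`. -/
structure Choices (T : AbelianTower.{w, v, u, v₂, u₂} J L n) (X : ι → C)
    (c : ∀ j, CechCochain (L j).obj X (j + 2)) where
  /-- objects `x_i` of the gerbe `F₂` over the `X_i` -/
  x : ι → T.F 0
  x_over : ∀ i, T.p₂.obj (x i) = X i
  /-- the restriction of `x_{i_r}` to `X_I` -/
  y : ∀ {k : ℕ} (_ : Fin k → ι) (_ : Fin k), T.F 0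
  /-- its cartesian arrow to `x_{i_r}` -/
  ρ : ∀ {k : ℕ} (I : Fin k → ι) (r : Fin k), y I r ⟶ x (I r)
  ρ_cart : ∀ {k : ℕ} (I : Fin k → ι) (r : Fin k),
    T.p₂.IsCartesian (Pi.π (fun s => X (I s)) r) (ρ I r)
  /-- arrows `g_{ij}` over `X_{ij}` from the restriction of `x_j` to the one of `x_i` -/
  g : ∀ i j : ι, y ![i, j] 1 ⟶ y ![i, j] 0
  g_over : ∀ i j, T.p₂.IsHomLift (𝟙 (cap X ![i, j])) (g i j)
  /-- the restriction of `g_{i_a i_b}` to `X_{i₀ i₁ i₂}` -/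
  γ : ∀ (I : Fin 3 → ι) (a b : Fin 3), y I b ⟶ y I a
  γ_over : ∀ I a b, T.p₂.IsHomLift (𝟙 (cap X I)) (γ I a b)
  γ_restrict : ∀ (I : Fin 3 → ι) (a b : Fin 3),
    ∃ (s : y I b ⟶ y ![I a, I b] 1) (s' : y I a ⟶ y ![I a, I b] 0),
      s ≫ ρ ![I a, I b] 1 = ρ I b ∧ s' ≫ ρ ![I a, I b] 0 = ρ I a ∧ s ≫ g (I a) (I b) = γ I a b ≫ s'
  /-- objects of `F_{j+2}` over the `X_I`, `I` with `j + 3` indices, used to compute `c_{j+2}` -/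
  obj : ∀ j, j + 2 ≤ n → (Fin (j + 3) → ι) → T.F j
  obj_over : ∀ j h I, (T.π j).obj (obj j h I) = cap X I
  /-- the object over `X_{i₀ i₁ i₂}` is the restriction of `x_{i₂}` -/
  toX : ∀ (h : 0 + 2 ≤ n) (I : Fin 3 → ι), obj 0 h I ⟶ x (I 2)
  toX_cart : ∀ (h : 0 + 2 ≤ n) (I : Fin 3 → ι), T.p₂.IsCartesian (Pi.π (fun s => X (I s)) 2) (toX h I)
  /-- the object of `F_{j+3}` over `X_I` lies over the restriction of the one of `F_{j+2}` for the
  tuple `I` without its last index -/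
  toObj : ∀ j h h' I, (T.p j).obj (obj (j + 1) h I) ⟶ obj j h' (I ∘ Fin.castSucc)
  toObj_cart : ∀ j h h' I, (T.π j).IsCartesian (capMap X I Fin.castSucc) (toObj j h h' I)
  /-- `c₂`: one has `g_{ij} g_{jk} = c_{ijk} g_{ik}` on `X_{ijk}` -/
  c_zero : 0 + 2 ≤ n → ∀ (I : Fin 3 → ι) (hy : (T.π 0).obj (y I 2) = cap X I),
    γ I 1 2 ≫ γ I 0 1 = T.actOn 0 (y I 2) hy (c 0 I) ≫ γ I 0 2
  /-- the lifts of `c_{j+2}` -/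
  lift : ∀ j, CechCochain (T.L' j).obj X (j + 2)
  /-- the lift of `c_{j+2}` acts on the chosen object of `F_{j+3}` as a lift of the action of
  `c_{j+2}` on its projection to `F_{j+2}` -/
  lift_spec : ∀ j (h : j + 1 + 2 ≤ n) (I : Fin (j + 4) → ι) (r : Fin (j + 4)),
    (T.p j).map (T.actOn' j (obj (j + 1) h I) (obj_over (j + 1) h I)
        ((T.L' j).obj.map (capMap X I r.succAbove).op (lift j (I ∘ r.succAbove)))) =
      T.actOn j ((T.p j).obj (obj (j + 1) h I)) (obj_over (j + 1) h I)
        ((L j).obj.map (capMap X I r.succAbove).op (c j (I ∘ r.succAbove)))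
  /-- `c_{j+3}` is the alternating sum of the lifts of `c_{j+2}` -/
  c_succ : ∀ j (h : j + 1 + 2 ≤ n) (I : Fin (j + 4) → ι),
    T.actOn (j + 1) (obj (j + 1) h I) (obj_over (j + 1) h I) (c (j + 1) I) =
      T.actOn' j (obj (j + 1) h I) (obj_over (j + 1) h I)
        (cechD (T.L' j).obj X (j + 2) (lift j) I)

/-- `c = (c₂, …, cₙ)` is a family of classifying cochains of the tower with respect to `X`. -/
def IsClassifying (T : AbelianTower.{w, v, u, v₂, u₂} J L n) (X : ι → C)
    (c : ∀ j, CechCochain (L j).obj X (j + 2)) : Prop :=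
  T.IsGoodCover X ∧ Nonempty (T.Choices X c)

end AbelianTower

end TorsorTower

end

namespace TorsorTower

/-! ### Fibred categories in which vertical arrows are invertible -/

section Fibred

variable {C : Type*} [Category* C] {X : Type*} [Category* X]

/-! Each level is fibred over the one below with invertible vertical arrows, so every arrow of a
level is strongly cartesian over the base (`existsUnique_lift`). Hence arrows into a fixed object
are determined by their composites with a given arrow and their projections, and over a connected
source every base arrow lifts (`exists_arrow`).

Consequently an identity between actions of sections needs to be checked on one object only
(`StableRel.mem_on_of_rel`). Over a connected `U` that carries an object of the upper level, the
automorphism groups then behave like a short exact sequence `0 → L (j+1) → L' j → L j → 0`. Its two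
maps are known only through actions on objects, so they are handled as relations, `inclRel` and
`liftRel`.

The cochain `c (j+1)` comes from `c j` by the connecting construction of this sequence
(`Choices.isConnecting`): lift, then apply the Čech differential. The usual diagram chase shows that
the result is a cocycle, that the construction is additive as a relation, and that a coboundary goes
to a coboundary. A morphism of towers preserves the construction (`TowerHom.isConnecting`). Thus, if
`c' j` differs by a coboundary from the transport `d' j` of `c j`, the same holds at `j+1`.

The induction starts in the gerbe. There the image of the transition arrows of the first tower is
classified by `d' 0`, and two systems of transition arrows in one gerbe have cohomologous cochains
(`Transition.IsClassifiedBy.exists_sub_eq`). The cocycle condition is the comparison of two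
evaluations of a triple composite of transition arrows. -/

theorem map_eq_of_isHomLift (p : X ⥤ C) {R S : C} {f : R ⟶ S} {x y : X} {φ : x ⟶ y}
    (h : p.IsHomLift f φ) (hx : p.obj x = R) (hy : p.obj y = S) :
    p.map φ ≫ eqToHom hy = eqToHom hx ≫ f := by
  cases h
  simp

theorem map_eq_id_of_isHomLift (p : X ⥤ C) {x : X} {φ : x ⟶ x}
    (h : p.IsHomLift (𝟙 (p.obj x)) φ) : p.map φ = 𝟙 _ := by
  simpa using map_eq_of_isHomLift p h rfl rfl

theorem isHomLift_id_of_map_eq (p : X ⥤ C) {x y : X} {φ : x ⟶ y} (h : p.obj x = p.obj y)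
    (e : p.map φ = eqToHom h) : p.IsHomLift (𝟙 (p.obj x)) φ :=
  IsHomLift.of_fac' _ _ _ rfl h.symm (by simp [e])

/-- In a category fibred over `C` whose vertical arrows are invertible every arrow is strongly
cartesian. -/
theorem existsUnique_lift_of_isFibered (p : X ⥤ C) (hp : p.IsFibered)
    (hiso : ∀ {x y : X} (φ : x ⟶ y), p.IsHomLift (𝟙 (p.obj x)) φ → IsIso φ)
    {x y z : X} (φ : x ⟶ y) (ψ : z ⟶ y) (g : p.obj z ⟶ p.obj x) (h : p.map ψ = g ≫ p.map φ) :
    ∃! χ : z ⟶ x, p.map χ = g ∧ χ ≫ φ = ψ := by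
  -- `φ` differs from a cartesian lift `κ` of its own projection by a vertical arrow `m`. As `m` is
  -- invertible, `φ` is cartesian, and in a fibred category this makes it strongly cartesian.
  obtain ⟨b, κ, hκ⟩ := Functor.IsPreFibered.exists_isCartesian' (p := p) (p.map φ)
  have hb : p.obj b = p.obj x := IsHomLift.domain_eq p (p.map φ) κ
  let m : x ⟶ b := Functor.IsCartesian.map p (p.map φ) κ φ
  have hm : p.IsHomLift (𝟙 (p.obj x)) m := inferInstance
  have hmκ : m ≫ κ = φ := Functor.IsCartesian.fac p (p.map φ) κ φ
  have : IsIso m := hiso m hm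
  have hc : p.IsCartesian (p.map φ) φ := by
    have : p.IsHomLift (𝟙 (p.obj x)) (asIso m).hom := hm
    simpa [hmκ] using Functor.IsCartesian.of_iso_comp p (p.map φ) κ (asIso m)
  have hs : p.IsStronglyCartesian (p.map φ) φ := inferInstance
  have hl : p.IsHomLift (g ≫ p.map φ) ψ := by rw [← h]; infer_instance
  obtain ⟨χ, ⟨h1, h2⟩, h3⟩ := hs.universal_property' g ψ
  refine ⟨χ, ⟨?_, h2⟩, fun χ' h' => h3 χ' ⟨?_, h'.2⟩⟩
  · exact (IsHomLift.eq_of_isHomLift p g χ).symm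
  · rw [← h'.1]; infer_instance

end Fibred

/-! ### Lifting arrows and restricting objects in a tower -/

namespace AbelianTower

variable {C : Type u} [Category.{v} C] {J : GrothendieckTopology C}
  {L : ℕ → Sheaf J AddCommGrpCat.{w}} {n : ℕ} (T : AbelianTower.{w, v, u, v₂, u₂} J L n)

/-- Every arrow of a level of the tower is strongly cartesian over the base. -/
theorem existsUnique_lift : ∀ (j : ℕ), j + 2 ≤ n → ∀ {x y z : T.F j} (φ : x ⟶ y) (ψ : z ⟶ y)
    (g : (T.π j).obj z ⟶ (T.π j).obj x), (T.π j).map ψ = g ≫ (T.π j).map φ →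
    ∃! χ : z ⟶ x, (T.π j).map χ = g ∧ χ ≫ φ = ψ
  | 0, hj, _, _, _, φ, ψ, g, h =>
    existsUnique_lift_of_isFibered T.p₂ (T.gerbe hj).fibered
      (fun φ hφ => T.isIso_of_isVertical 0 hj φ hφ) φ ψ g h
  | j + 1, hj, x, y, z, φ, ψ, g, h => by
    -- The factor is built in two stages: `g` lifts to `g'` one level below, and `g'` is then the
    -- projection prescribed for `χ`.
    obtain ⟨g', ⟨h1, h2⟩, h3⟩ := existsUnique_lift j (by omega) ((T.p j).map φ) ((T.p j).map ψ) g h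
    obtain ⟨χ, ⟨h4, h5⟩, h6⟩ := existsUnique_lift_of_isFibered (T.p j) (T.fibered j (by omega))
      (fun φ hφ => T.isIso_of_isVertical (j + 1) hj φ hφ) φ ψ g' h2.symm
    refine ⟨χ, ⟨(congrArg (T.π j).map h4).trans h1, h5⟩, fun χ' h' => h6 χ' ⟨?_, h'.2⟩⟩
    refine h3 _ ⟨h'.1, ?_⟩
    rw [← Functor.map_comp, h'.2]

/-- The uniqueness half of cartesianness: relative to the base, every arrow can be cancelled on the
right. -/
theorem hom_ext_of_comp {j : ℕ} (hj : j + 2 ≤ n) {x y z : T.F j} (φ : x ⟶ y) {χ χ' : z ⟶ x}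
    (h : (T.π j).map χ = (T.π j).map χ') (h' : χ ≫ φ = χ' ≫ φ) : χ = χ' :=
  (T.existsUnique_lift j hj φ (χ' ≫ φ) ((T.π j).map χ') (by simp)).unique ⟨h, h'⟩ ⟨rfl, rfl⟩

theorem exists_lift {j : ℕ} (hj : j + 2 ≤ n) {x y z : T.F j} (φ : x ⟶ y) (ψ : z ⟶ y)
    (g : (T.π j).obj z ⟶ (T.π j).obj x) (h : (T.π j).map ψ = g ≫ (T.π j).map φ) :
    ∃ χ : z ⟶ x, (T.π j).map χ = g ∧ χ ≫ φ = ψ :=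
  (T.existsUnique_lift j hj φ ψ g h).exists

/-- Objects of a level can be restricted along arrows of the base. -/
theorem exists_restriction : ∀ (j : ℕ), j + 2 ≤ n → ∀ (y : T.F j) {V : C}
    (f : V ⟶ (T.π j).obj y), ∃ (x : T.F j) (φ : x ⟶ y) (h : (T.π j).obj x = V),
      (T.π j).map φ = eqToHom h ≫ f
  | 0, hj, y, V, f => by
    have := (T.gerbe hj).fibered
    change V ⟶ T.p₂.obj y at f
    obtain ⟨x, φ, h⟩ := Functor.IsPreFibered.exists_isCartesian' (p := T.p₂) (a := y) f
    have hx := IsHomLift.domain_eq T.p₂ f φ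
    refine ⟨x, φ, hx, ?_⟩
    have e := map_eq_of_isHomLift T.p₂ h.toIsHomLift hx rfl
    rw [eqToHom_refl, Category.comp_id] at e
    exact e
  | j + 1, hj, y, V, f => by
    obtain ⟨x', φ', rfl, h'⟩ := exists_restriction j (by omega) ((T.p j).obj y) f
    have := T.fibered j (by omega)
    obtain ⟨x, φ, h⟩ := Functor.IsPreFibered.exists_isCartesian' (p := T.p j) φ'
    have hx := IsHomLift.domain_eq (T.p j) φ' φ
    have e := map_eq_of_isHomLift (T.p j) h.toIsHomLift hx rfl
    refine ⟨x, φ, congrArg (T.π j).obj hx, ?_⟩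
    have e' := congrArg (T.π j).map e
    simp only [Functor.map_comp, eqToHom_map, eqToHom_refl, Category.comp_id, h'] at e'
    exact e'.trans (congrArg (eqToHom _ ≫ ·) (Category.id_comp f))

theorem isIso_of_map_isIso {j : ℕ} (hj : j + 2 ≤ n) {x y : T.F j} (φ : x ⟶ y)
    (h : IsIso ((T.π j).map φ)) : IsIso φ := by
  obtain ⟨χ, h1, h2⟩ := T.exists_lift hj φ (𝟙 y) (inv ((T.π j).map φ)) (by simp)
  refine ⟨χ, T.hom_ext_of_comp hj φ ?_ ?_, h2⟩
  · simp [h1]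
  · simp [h2]

/-- The object `V` is isomorphic to a connected object for the tower. -/
def Conn (V : C) : Prop := ∃ W : C, T.IsConnected n W ∧ Nonempty (V ≅ W)

variable {T} in
theorem Conn.of_iso {V V' : C} (h : T.Conn V) (e : V' ≅ V) : T.Conn V' := by
  obtain ⟨W, hW, ⟨e'⟩⟩ := h
  exact ⟨W, hW, ⟨e ≪≫ e'⟩⟩

/-- Arrows of the base lift to a given level if the source is connected. -/
theorem exists_arrow {j : ℕ} (hj : j + 2 ≤ n) {x y : T.F j} (hx : T.Conn ((T.π j).obj x))
    (f : (T.π j).obj x ⟶ (T.π j).obj y) : ∃ φ : x ⟶ y, (T.π j).map φ = f := by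
  obtain ⟨W, hW, ⟨e⟩⟩ := hx
  -- Both objects are restricted to the connected `W`, where an isomorphism over the identity
  -- exists; the arrow sought is `x ⟶ x' ≅ y' ⟶ y`.
  obtain ⟨x', m, rfl, hm⟩ := T.exists_restriction j hj x e.inv
  obtain ⟨y', k, h, hk⟩ := T.exists_restriction j hj y (e.inv ≫ f)
  obtain ⟨χ, h1, -⟩ := T.exists_lift hj m (𝟙 x) e.hom (by simp [hm])
  obtain ⟨i, hi⟩ := hW.base j hj x' y' rfl h
  refine ⟨χ ≫ i.hom ≫ k, ?_⟩
  have := map_eq_of_isHomLift _ hi rfl h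
  simp only [Category.comp_id, eqToHom_refl] at this
  simp only [Functor.map_comp, hk, h1]
  rw [← Category.assoc ((T.π j).map i.hom), this]
  simp

/-! ### The action of the bands -/

/-- Restriction of sections of a presheaf of abelian groups. -/
abbrev res (G : Cᵒᵖ ⥤ AddCommGrpCat.{w}) {V U : C} (f : V ⟶ U) :
    G.obj (op U) →+ G.obj (op V) := (G.map f.op).hom

theorem res_comp (G : Cᵒᵖ ⥤ AddCommGrpCat.{w}) {V U W : C} (f : W ⟶ V) (g : V ⟶ U)
    (a : G.obj (op U)) : res G (f ≫ g) a = res G f (res G g a) := by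
  simp [res]

theorem res_id (G : Cᵒᵖ ⥤ AddCommGrpCat.{w}) {U : C} (a : G.obj (op U)) :
    res G (𝟙 U) a = a := by
  simp [res]

/-- The automorphism of `x` given by a section of the band. -/
def aut {j : ℕ} (x : T.F j) (a : (L j).obj.obj (op ((T.π j).obj x))) : x ⟶ x :=
  (T.act j x a).toMul.hom

/-- The automorphism of `x` given by a section of `L'`. -/
def aut' {j : ℕ} (x : T.F (j + 1)) (a : (T.L' j).obj.obj (op ((T.π (j + 1)).obj x))) : x ⟶ x :=
  (T.act' j x a).toMul.hom

theorem actOn_eq {j : ℕ} {U : C} (x : T.F j) (hx : (T.π j).obj x = U)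
    (a : (L j).obj.obj (op U)) : T.actOn j x hx a = T.aut x (res _ (eqToHom hx) a) := rfl

theorem aut_zero {j : ℕ} (x : T.F j) : T.aut x 0 = 𝟙 x := by
  simp [aut]; rfl

theorem aut'_zero {j : ℕ} (x : T.F (j + 1)) : T.aut' x 0 = 𝟙 x := by
  simp [aut']; rfl

theorem aut_add {j : ℕ} (x : T.F j) (a b) : T.aut x (a + b) = T.aut x a ≫ T.aut x b := by
  -- Multiplication in `Aut` is composition in the reverse order, hence the swap.
  rw [add_comm a b, aut, map_add]; rfl

theorem aut'_add {j : ℕ} (x : T.F (j + 1)) (a b) :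
    T.aut' x (a + b) = T.aut' x a ≫ T.aut' x b := by
  rw [add_comm a b, aut', map_add]; rfl

theorem aut_injective {j : ℕ} (hj : j + 2 ≤ n) (x : T.F j) : Function.Injective (T.aut x) :=
  fun _ _ h => T.act_injective j hj x (Additive.toMul.injective (Iso.ext h))

theorem aut_comp {j : ℕ} (hj : j + 2 ≤ n) {x y : T.F j} (φ : x ⟶ y) (a) :
    T.aut x (res _ ((T.π j).map φ) a) ≫ φ = φ ≫ T.aut y a :=
  T.act_natural j hj φ a

theorem aut'_comp {j : ℕ} (hj : j + 3 ≤ n) {x y : T.F (j + 1)} (φ : x ⟶ y) (a) :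
    T.aut' x (res _ ((T.π (j + 1)).map φ) a) ≫ φ = φ ≫ T.aut' y a :=
  T.act'_natural j hj φ a

theorem p₂_map_aut (hj : 0 + 2 ≤ n) (x : T.F 0) (a) : T.p₂.map (T.aut x a) = 𝟙 _ :=
  map_eq_id_of_isHomLift _ ((T.act_range 0 hj x _).1 ⟨a, rfl⟩)

theorem p_map_aut {j : ℕ} (hj : j + 3 ≤ n) (x : T.F (j + 1)) (a) :
    (T.p j).map (T.aut x a) = 𝟙 _ :=
  map_eq_id_of_isHomLift _ ((T.act_range (j + 1) (by omega) x _).1 ⟨a, rfl⟩)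

theorem π_map_aut : ∀ {j : ℕ}, j + 2 ≤ n → ∀ (x : T.F j) (a), (T.π j).map (T.aut x a) = 𝟙 _
  | 0, hj, x, a => T.p₂_map_aut hj x a
  | j + 1, hj, x, a => (congrArg (T.π j).map (T.p_map_aut hj x a)).trans ((T.π j).map_id _)

theorem exists_aut_of_p_map_eq_id {j : ℕ} (hj : j + 3 ≤ n) {x : T.F (j + 1)} {f : x ⟶ x}
    (h : (T.p j).map f = 𝟙 _) : ∃ a, T.aut x a = f := by
  have hv : (T.p j).IsHomLift (𝟙 ((T.p j).obj x)) f := isHomLift_id_of_map_eq _ rfl h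
  have := T.isIso_of_isVertical (j + 1) (by omega) f hv
  obtain ⟨a, ha⟩ := (T.act_range (j + 1) (by omega) x (asIso f)).2 hv
  exact ⟨a, congrArg Iso.hom ha⟩

theorem exists_aut_of_p₂_map_eq_id (hj : 0 + 2 ≤ n) {x : T.F 0} {f : x ⟶ x}
    (h : T.p₂.map f = 𝟙 _) : ∃ a, T.aut x a = f := by
  have hv : T.p₂.IsHomLift (𝟙 (T.p₂.obj x)) f := isHomLift_id_of_map_eq _ rfl h
  have := T.isIso_of_isVertical 0 hj f hv
  obtain ⟨a, ha⟩ := (T.act_range 0 hj x (asIso f)).2 hv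
  exact ⟨a, congrArg Iso.hom ha⟩

theorem p_map_aut' {j : ℕ} (hj : j + 3 ≤ n) (x : T.F (j + 1)) (a) :
    ∃ b, (T.p j).map (T.aut' x a) = T.aut ((T.p j).obj x) b := by
  have hv := (T.act'_range j hj x _).1 ⟨a, rfl⟩
  obtain ⟨b, hb⟩ := (T.act_range j (by omega) _ ((T.p j).mapIso (T.act' j x a).toMul)).2 hv
  exact ⟨b, (congrArg Iso.hom hb).symm⟩

theorem π_map_aut' {j : ℕ} (hj : j + 3 ≤ n) (x : T.F (j + 1)) (a) :
    (T.π (j + 1)).map (T.aut' x a) = 𝟙 _ := by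
  obtain ⟨b, hb⟩ := T.p_map_aut' hj x a
  exact (congrArg (T.π j).map hb).trans (T.π_map_aut (by omega) _ b)

/-- Such an `f` lies over an identity of the base, so it is invertible by cartesianness, and
`act'_range` applies. -/
theorem exists_aut' {j : ℕ} (hj : j + 3 ≤ n) {x : T.F (j + 1)} {f : x ⟶ x} {b}
    (h : (T.p j).map f = T.aut ((T.p j).obj x) b) : ∃ a, T.aut' x a = f := by
  have hi : IsIso f := T.isIso_of_map_isIso (j := j + 1) (by omega) f (by
    have : (T.π (j + 1)).map f = 𝟙 _ :=
      (congrArg (T.π j).map h).trans (T.π_map_aut (by omega) _ b)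
    rw [this]; infer_instance)
  have hv : T.IsVertical ((T.p j).map (asIso f).hom) := by
    rw [asIso_hom, h]
    exact (T.act_range j (by omega) _ (T.act j ((T.p j).obj x) b).toMul).1 ⟨b, rfl⟩
  obtain ⟨a, ha⟩ := (T.act'_range j hj x (asIso f)).2 hv
  exact ⟨a, congrArg Iso.hom ha⟩

theorem aut_cancel {j : ℕ} (hj : j + 2 ≤ n) {x y : T.F j} (φ : x ⟶ y) {a b}
    (h : T.aut x a ≫ φ = T.aut x b ≫ φ) : a = b :=
  T.aut_injective hj x (T.hom_ext_of_comp hj φ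
    ((T.π_map_aut hj x a).trans (T.π_map_aut hj x b).symm) h)

/-- In the gerbe, two arrows over the same arrow of the base differ by a section of the band. -/
theorem exists_aut_comp (hj : 0 + 2 ≤ n) {x y : T.F 0} (φ ψ : x ⟶ y)
    (h : (T.π 0).map φ = (T.π 0).map ψ) : ∃ a, φ = T.aut x a ≫ ψ := by
  obtain ⟨χ, h1, h2⟩ := T.exists_lift hj ψ φ (𝟙 _) (by simp [h])
  obtain ⟨a, ha⟩ := T.exists_aut_of_p₂_map_eq_id hj (f := χ) h1
  exact ⟨a, by rw [ha, h2]⟩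

end AbelianTower

end TorsorTower

noncomputable section

namespace TorsorTower

/-! ### The Čech complex and degenerate tuples -/

section Cech

variable {C : Type u} [Category.{v} C] [HasFiniteProducts C] {ι : Type t}

@[simp]
theorem capMap_π (X : ι → C) {k l : ℕ} (I : Fin k → ι) (e : Fin l → Fin k) (s : Fin l) :
    capMap X I e ≫ Pi.π (fun s => X ((I ∘ e) s)) s = Pi.π (fun r => X (I r)) (e s) :=
  Pi.lift_π _ _

theorem capMap_comp (X : ι → C) {k l m : ℕ} (I : Fin k → ι) (e : Fin l → Fin k)
    (e' : Fin m → Fin l) :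
    capMap X I (e ∘ e') = capMap X I e ≫ capMap X (I ∘ e) e' := by
  refine Pi.hom_ext _ _ fun s => ?_
  have h1 : capMap X I (e ∘ e') ≫ Pi.π (fun s => X (((I ∘ e) ∘ e') s)) s =
    Pi.π (fun r => X (I r)) (e (e' s)) := Pi.lift_π _ _
  exact h1.trans ((Category.assoc _ _ _).trans ((congrArg (capMap X I e ≫ ·)
    (capMap_π X (I ∘ e) e' s)).trans (capMap_π X I e (e' s)))).symm

/-- The cosimplicial group of Čech cochains. -/
def cechCosimplicial (G : Cᵒᵖ ⥤ AddCommGrpCat.{w}) (X : ι → C) :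
    CosimplicialObject AddCommGrpCat.{max t w} where
  obj Δ := AddCommGrpCat.of (CechCochain G X Δ.len)
  map e := AddCommGrpCat.ofHom
    { toFun := fun c I => G.map (capMap X I e.toOrderHom).op (c (I ∘ e.toOrderHom))
      map_zero' := by funext I; simp
      map_add' := fun c c' => by funext I; simp }
  map_id Δ := by
    ext c I
    have h : capMap X I (SimplexCategory.Hom.toOrderHom (𝟙 Δ)) = 𝟙 _ := by
      apply Pi.hom_ext
      intro s
      exact (Pi.lift_π _ _).trans (Category.id_comp _).symm
    change G.map (capMap X I (SimplexCategory.Hom.toOrderHom (𝟙 Δ))).op (c I) = c I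
    rw [h]
    exact ConcreteCategory.congr_hom (G.map_id _) (c I)
  map_comp {Δ₁ Δ₂ Δ₃} e e' := by
    ext c I
    change G.map (capMap X I (e'.toOrderHom ∘ e.toOrderHom)).op
        (c ((I ∘ e'.toOrderHom) ∘ e.toOrderHom)) =
      G.map (capMap X I e'.toOrderHom).op (G.map (capMap X (I ∘ e'.toOrderHom) e.toOrderHom).op
        (c ((I ∘ e'.toOrderHom) ∘ e.toOrderHom)))
    refine (congrArg (fun f => G.map (Quiver.Hom.op f) (c ((I ∘ e'.toOrderHom) ∘ e.toOrderHom)))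
      (capMap_comp X I e'.toOrderHom e.toOrderHom)).trans ?_
    exact AbelianTower.res_comp G _ _ _

/-- The Čech differential is the alternating sum of the cofaces of `cechCosimplicial`, whose square
vanishes in general. -/
theorem cechD_comp_cechD (G : Cᵒᵖ ⥤ AddCommGrpCat.{w}) (X : ι → C) (k : ℕ)
    (c : CechCochain G X k) : cechD G X (k + 1) (cechD G X k c) = 0 := by
  have key : ∀ m, AlgebraicTopology.AlternatingCofaceMapComplex.objD (cechCosimplicial G X) m =
      AddCommGrpCat.ofHom (cechD G X m) := by
    intro m
    refine AddCommGrpCat.homAddEquiv.injective ?_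
    rw [AlgebraicTopology.AlternatingCofaceMapComplex.objD, map_sum]
    refine AddMonoidHom.ext fun c => funext fun I => ?_
    refine (congrFun (AddMonoidHom.finsetSum_apply _ _ c) I).trans ?_
    exact Finset.sum_apply I _ _
  have h := AlgebraicTopology.AlternatingCofaceMapComplex.d_squared (cechCosimplicial G X) k
  rw [key, key] at h
  exact ConcreteCategory.congr_hom h c

theorem cechD_apply (G : Cᵒᵖ ⥤ AddCommGrpCat.{w}) (X : ι → C) (k : ℕ) (c : CechCochain G X k)
    (I : Fin (k + 2) → ι) : cechD G X k c I = ∑ r : Fin (k + 2), (-1 : ℤ) ^ (r : ℕ) •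
      AbelianTower.res G (capMap X I r.succAbove) (c (I ∘ r.succAbove)) := rfl

/-- Every tuple of indices is a face of a degenerate one. -/
theorem exists_succAbove_comp_eq (X : ι → C) {m : ℕ} (J : Fin (m + 1) → ι) :
    ∃ (I : Fin (m + 2) → ι) (r : Fin (m + 2)), I ∘ r.succAbove = J ∧
      ∃ s : cap X (I ∘ r.succAbove) ⟶ cap X I, s ≫ capMap X I r.succAbove = 𝟙 _ := by
  have h0 : ∀ t : Fin (m + 1), Fin.predAbove 0 (Fin.succAbove 0 t) = t := by simp
  have h1 : (J ∘ Fin.predAbove 0) ∘ Fin.succAbove 0 = J := by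
    funext t
    simp only [Function.comp_apply, h0]
  -- The tuple with its first index repeated: its face `0` is `J`, and the section `s` duplicates
  -- the first factor.
  refine ⟨J ∘ Fin.predAbove 0, 0, h1,
    Pi.lift fun i => Pi.π _ (Fin.predAbove 0 i) ≫
      eqToHom (congrArg X (congrFun h1 (Fin.predAbove 0 i))), ?_⟩
  apply Pi.hom_ext
  intro t
  rw [Category.assoc, capMap_π, Pi.lift_π, Category.id_comp]
  exact Pi.π_comp_eqToHom _ (h0 t)

end Cech

namespace AbelianTower

variable {C : Type u} [Category.{v} C] {J : GrothendieckTopology C}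
  {L : ℕ → Sheaf J AddCommGrpCat.{w}} {n : ℕ} (T : AbelianTower.{w, v, u, v₂, u₂} J L n)

/-! ### Relations between sections that are stable under restriction -/

/-- A relation between the sections of two presheaves over the projections of the objects of a
level, compatible with the arrows of the level. -/
structure StableRel (j : ℕ) (G H : Cᵒᵖ ⥤ AddCommGrpCat.{w}) where
  /-- the relation at an object -/
  rel : ∀ x : T.F j, AddSubgroup (G.obj (op ((T.π j).obj x)) × H.obj (op ((T.π j).obj x)))
  res_mem : ∀ {x y : T.F j} (φ : x ⟶ y) {a b}, (a, b) ∈ rel y →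
    (res G ((T.π j).map φ) a, res H ((T.π j).map φ) b) ∈ rel x

namespace StableRel

variable {T} {j : ℕ} {G H : Cᵒᵖ ⥤ AddCommGrpCat.{w}} (R : T.StableRel j G H)

/-- The relation at an object of the base: it holds at all objects of the level with connected
projection. -/
def on (U : C) : AddSubgroup (G.obj (op U) × H.obj (op U)) where
  carrier := {p | ∀ x, T.Conn ((T.π j).obj x) → ∀ θ : (T.π j).obj x ⟶ U,
    (res G θ p.1, res H θ p.2) ∈ R.rel x}
  zero_mem' x _ θ := by
    simp only [Prod.fst_zero, Prod.snd_zero, map_zero]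
    exact (R.rel x).zero_mem
  add_mem' h h' x hx θ := by
    simpa using (R.rel x).add_mem (h x hx θ) (h' x hx θ)
  neg_mem' h x hx θ := by
    simpa using (R.rel x).neg_mem (h x hx θ)

theorem res_mem_on {U V : C} (f : V ⟶ U) {a b} (h : (a, b) ∈ R.on U) :
    (res G f a, res H f b) ∈ R.on V := by
  intro x hx θ
  simpa only [res_comp] using h x hx (θ ≫ f)

/-- One object over `U` suffices: any object with connected projection over `U` has an arrow to `x`
by `exists_arrow`, and the relation restricts along it. -/
theorem mem_on_of_rel (hj : j + 2 ≤ n) {U : C} (x : T.F j) (θ : (T.π j).obj x ⟶ U) [IsIso θ] {a b}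
    (h : (res G θ a, res H θ b) ∈ R.rel x) : (a, b) ∈ R.on U := by
  intro y hy η
  obtain ⟨φ, hφ⟩ := T.exists_arrow hj hy (η ≫ inv θ)
  have := R.res_mem φ h
  rw [← res_comp, ← res_comp, hφ, Category.assoc, IsIso.inv_hom_id, Category.comp_id] at this
  exact this

variable [HasFiniteProducts C] {ι : Type t} {X : ι → C}

theorem cechD_mem_on {k : ℕ} {c : CechCochain G X k} {d : CechCochain H X k}
    (h : ∀ I, (c I, d I) ∈ R.on (cap X I)) (I : Fin (k + 2) → ι) :
    (cechD G X k c I, cechD H X k d I) ∈ R.on (cap X I) := by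
  have : (cechD G X k c I, cechD H X k d I) = ∑ r : Fin (k + 2), (-1 : ℤ) ^ (r : ℕ) •
      (res G (capMap X I r.succAbove) (c (I ∘ r.succAbove)),
        res H (capMap X I r.succAbove) (d (I ∘ r.succAbove))) := by
    ext <;> simp [cechD_apply, Prod.fst_sum, Prod.snd_sum]
  rw [this]
  exact sum_mem fun r _ => zsmul_mem (R.res_mem_on _ (h _)) _

end StableRel

/-! ### The relations that replace the exact sequence of `L (j+1)`, `L' j` and `L j` -/

instance {j : ℕ} (x : T.F j) (a) : IsIso (T.aut x a) :=
  Iso.isIso_hom (Additive.toMul (T.act j x a) : Aut x)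

instance {j : ℕ} (x : T.F (j + 1)) (a) : IsIso (T.aut' x a) :=
  Iso.isIso_hom (Additive.toMul (T.act' j x a) : Aut x)

theorem aut_neg {j : ℕ} (x : T.F j) (a) : T.aut x (-a) = inv (T.aut x a) :=
  IsIso.eq_inv_of_hom_inv_id (by rw [← aut_add, add_neg_cancel, aut_zero])

theorem aut'_neg {j : ℕ} (x : T.F (j + 1)) (a) : T.aut' x (-a) = inv (T.aut' x a) :=
  IsIso.eq_inv_of_hom_inv_id (by rw [← aut'_add, add_neg_cancel, aut'_zero])

/-- The automorphism of the image of `x` one level below given by a section of the band. -/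
def autBelow {j : ℕ} (x : T.F (j + 1)) (b : (L j).obj.obj (op ((T.π (j + 1)).obj x))) :
    (T.p j).obj x ⟶ (T.p j).obj x :=
  T.aut ((T.p j).obj x) b

theorem autBelow_zero {j : ℕ} (x : T.F (j + 1)) : T.autBelow x 0 = 𝟙 _ := T.aut_zero _

theorem autBelow_add {j : ℕ} (x : T.F (j + 1)) (a b) :
    T.autBelow x (a + b) = T.autBelow x a ≫ T.autBelow x b := T.aut_add _ _ _

theorem autBelow_neg_comp {j : ℕ} (x : T.F (j + 1)) (a) :
    T.autBelow x (-a) ≫ T.autBelow x a = 𝟙 _ := by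
  rw [← autBelow_add, neg_add_cancel, autBelow_zero]

theorem autBelow_comp {j : ℕ} (hj : j + 2 ≤ n) {x y : T.F (j + 1)} (φ : x ⟶ y) (a) :
    T.autBelow x (res _ ((T.π (j + 1)).map φ) a) ≫ (T.p j).map φ =
      (T.p j).map φ ≫ T.autBelow y a :=
  T.aut_comp hj ((T.p j).map φ) a

/-- A section of `L'` lifts a section of `L` if its action on an object projects to the action of
the latter one level below. -/
def liftRel (j : ℕ) (hj : j + 3 ≤ n) : T.StableRel (j + 1) (T.L' j).obj (L j).obj where
  rel x :=
    { carrier := {q | (T.p j).map (T.aut' x q.1) = T.autBelow x q.2}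
      zero_mem' := by
        change (T.p j).map (T.aut' x 0) = T.autBelow x 0
        rw [autBelow_zero, aut'_zero, CategoryTheory.Functor.map_id]
      add_mem' := fun {q q'} h h' => by
        change (T.p j).map (T.aut' x (q.1 + q'.1)) = T.autBelow x (q.2 + q'.2)
        rw [autBelow_add, aut'_add, Functor.map_comp]
        exact congrArg₂ (· ≫ ·) h h'
      neg_mem' := fun {q} h => by
        change (T.p j).map (T.aut' x (-q.1)) = T.autBelow x (-q.2)
        change (T.p j).map (T.aut' x q.1) = _ at h
        rw [aut'_neg, Functor.map_inv, IsIso.inv_eq_of_inv_hom_id]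
        rw [h, autBelow_neg_comp] }
  res_mem {x y} φ a b h := by
    change (T.p j).map (T.aut' x _) = T.autBelow x _
    change (T.p j).map (T.aut' y a) = T.autBelow y b at h
    refine T.hom_ext_of_comp (by omega) ((T.p j).map φ) ?_ ?_
    · exact (T.π_map_aut' hj x _).trans (T.π_map_aut (by omega) ((T.p j).obj x) _).symm
    · rw [← Functor.map_comp, T.aut'_comp hj φ, Functor.map_comp, h]
      exact (T.autBelow_comp (by omega) φ b).symm

/-- A section of `L'` equals a section of `L` if they act by the same automorphisms. -/
def inclRel (j : ℕ) (hj : j + 3 ≤ n) : T.StableRel (j + 1) (T.L' j).obj (L (j + 1)).obj where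
  rel x :=
    { carrier := {q | T.aut' x q.1 = T.aut x q.2}
      zero_mem' := by
        change T.aut' x 0 = T.aut x 0
        rw [aut_zero, aut'_zero]
      add_mem' := fun {q q'} h h' => by
        change T.aut' x (q.1 + q'.1) = T.aut x (q.2 + q'.2)
        rw [aut_add, aut'_add]
        exact congrArg₂ (· ≫ ·) h h'
      neg_mem' := fun {q} h => by
        change T.aut' x (-q.1) = T.aut x (-q.2)
        change T.aut' x q.1 = _ at h
        simp only [aut_neg, aut'_neg, h] }
  res_mem {x y} φ a b h := by
    change T.aut' x _ = T.aut x _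
    change T.aut' y a = T.aut y b at h
    refine T.hom_ext_of_comp (by omega) φ ?_ ?_
    · exact (T.π_map_aut' hj x _).trans (T.π_map_aut (by omega) _ _).symm
    · rw [T.aut'_comp hj φ, h, T.aut_comp (by omega)]

theorem mem_liftRel {j : ℕ} {hj : j + 3 ≤ n} {x : T.F (j + 1)} {a b} :
    (a, b) ∈ (T.liftRel j hj).rel x ↔ (T.p j).map (T.aut' x a) = T.autBelow x b :=
  Iff.rfl

theorem mem_inclRel {j : ℕ} {hj : j + 3 ≤ n} {x : T.F (j + 1)} {a b} :
    (a, b) ∈ (T.inclRel j hj).rel x ↔ T.aut' x a = T.aut x b := Iff.rfl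

/-- Over a connected object of the base, every section of `L` lifts to `L'`. -/
theorem exists_mem_liftRel {j : ℕ} (hj : j + 3 ≤ n) {U : C} (hU : T.IsConnected n U)
    (x : T.F (j + 1)) (hx : (T.π (j + 1)).obj x = U) (b : (L j).obj.obj (op U)) :
    ∃ a, (a, b) ∈ (T.liftRel j hj).on U := by
  subst hx
  have := T.fibered j hj
  obtain ⟨x', κ, hκ⟩ := Functor.IsPreFibered.exists_isCartesian' (p := T.p j)
    (T.autBelow x b)
  have hx' : (T.p j).obj x' = (T.p j).obj x := IsHomLift.domain_eq (T.p j) (T.autBelow x b) κ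
  have hκ' := map_eq_of_isHomLift (T.p j) hκ.toIsHomLift hx' rfl
  -- The source of the cartesian lift `κ` has the same image as `x` one level below. Connectedness
  -- relative to that level identifies it with `x`, which turns `κ` into an endomorphism of `x`.
  obtain ⟨i, hi⟩ := hU.level j 1 (by omega) x x' rfl (congrArg (T.π j).obj hx') hx'.symm
  have hi' : (T.p j).map i.hom ≫ eqToHom hx' = 𝟙 _ :=
    (map_eq_of_isHomLift (T.down j 1) hi rfl hx').trans (Category.comp_id _)
  have hf : (T.p j).map (i.hom ≫ κ) = T.autBelow x b := by
    rw [eqToHom_refl, Category.comp_id] at hκ'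
    rw [Functor.map_comp, hκ', ← Category.assoc, hi', Category.id_comp]
  obtain ⟨a, ha⟩ := T.exists_aut' hj hf
  refine ⟨a, (T.liftRel j hj).mem_on_of_rel (by omega) x (𝟙 _) ?_⟩
  rw [res_id, res_id, mem_liftRel, ha, hf]

/-- A lift of the zero section of `L` is given by a section of the next band. -/
theorem exists_mem_inclRel {j : ℕ} (hj : j + 3 ≤ n) {U : C} (hU : T.IsConnected n U)
    (x : T.F (j + 1)) (hx : (T.π (j + 1)).obj x = U) {a : (T.L' j).obj.obj (op U)}
    (ha : (a, 0) ∈ (T.liftRel j hj).on U) : ∃ b, (a, b) ∈ (T.inclRel j hj).on U := by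
  subst hx
  have h := ha x ⟨_, hU, ⟨Iso.refl _⟩⟩ (𝟙 _)
  simp only [res_id, mem_liftRel, map_zero, autBelow_zero] at h
  obtain ⟨b, hb⟩ := T.exists_aut_of_p_map_eq_id hj h
  refine ⟨b, (T.inclRel j hj).mem_on_of_rel (by omega) x (𝟙 _) ?_⟩
  rw [res_id, res_id, mem_inclRel, hb]

/-- Exactness on the left: the band acts faithfully on any object over `U`. -/
theorem eq_zero_of_mem_inclRel {j : ℕ} (hj : j + 3 ≤ n) {U : C} (hU : T.IsConnected n U)
    (x : T.F (j + 1)) (hx : (T.π (j + 1)).obj x = U) {b : (L (j + 1)).obj.obj (op U)}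
    (hb : (0, b) ∈ (T.inclRel j hj).on U) : b = 0 := by
  subst hx
  have h := hb x ⟨_, hU, ⟨Iso.refl _⟩⟩ (𝟙 _)
  rw [map_zero, res_id, mem_inclRel, aut'_zero, ← aut_zero] at h
  exact (T.aut_injective (by omega) x h).symm

/-! ### The connecting construction on Čech cochains -/

section Connecting

variable [HasFiniteProducts C] {ι : Type t} (X : ι → C)

/-- All the `X_I` are projections of objects of the level `j`. -/
def HasObjects (j : ℕ) : Prop :=
  ∀ (k : ℕ) (I : Fin (k + 1) → ι), ∃ x : T.F j, (T.π j).obj x = cap X I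

/-- `d` is obtained from `c` by lifting `c` to a cochain with values in `L'` and taking the Čech
differential. -/
def IsConnecting (j : ℕ) (hj : j + 3 ≤ n) {k : ℕ} (c : CechCochain (L j).obj X k)
    (d : CechCochain (L (j + 1)).obj X (k + 1)) : Prop :=
  ∃ ℓ : CechCochain (T.L' j).obj X k, (∀ I, (ℓ I, c I) ∈ (T.liftRel j hj).on (cap X I)) ∧
    ∀ I, (cechD _ X k ℓ I, d I) ∈ (T.inclRel j hj).on (cap X I)

variable {T X} {j : ℕ} {hj : j + 3 ≤ n} {k : ℕ}

theorem IsConnecting.sub {c c' : CechCochain (L j).obj X k}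
    {d d' : CechCochain (L (j + 1)).obj X (k + 1)} (h : T.IsConnecting X j hj c d)
    (h' : T.IsConnecting X j hj c' d') : T.IsConnecting X j hj (c - c') (d - d') := by
  obtain ⟨ℓ, h1, h2⟩ := h
  obtain ⟨ℓ', h1', h2'⟩ := h'
  refine ⟨ℓ - ℓ', fun I => sub_mem (h1 I) (h1' I), fun I => ?_⟩
  rw [map_sub]
  exact sub_mem (h2 I) (h2' I)

/-- In `L'` the differential of `d` corresponds to the differential of a coboundary, which is zero.
-/
theorem IsConnecting.cechD_eq_zero (hX : T.IsGoodCover X) (hT : T.HasObjects X (j + 1))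
    {c : CechCochain (L j).obj X k} {d : CechCochain (L (j + 1)).obj X (k + 1)}
    (h : T.IsConnecting X j hj c d) : cechD _ X (k + 1) d = 0 := by
  obtain ⟨ℓ, -, h⟩ := h
  funext I
  obtain ⟨x, hx⟩ := hT _ I
  refine T.eq_zero_of_mem_inclRel hj (hX.connected _ I) x hx ?_
  have := (T.inclRel j hj).cechD_mem_on h I
  rwa [cechD_comp_cechD] at this

/-- If `f` lifts `e`, then `ℓ - δf` lifts `δe - δe = 0`, so it comes from a cochain `m` of the next
band. Both `δm` and `d` correspond to `δℓ` in `L'`, hence they agree. -/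
theorem IsConnecting.exists_cechD_eq (hX : T.IsGoodCover X) (hT : T.HasObjects X (j + 1))
    {e : CechCochain (L j).obj X k} {d : CechCochain (L (j + 1)).obj X (k + 2)}
    (h : T.IsConnecting X j hj (cechD _ X k e) d) : ∃ m, cechD _ X (k + 1) m = d := by
  obtain ⟨ℓ, h1, h2⟩ := h
  have hs : ∀ I, ∃ a, (a, e I) ∈ (T.liftRel j hj).on (cap X I) := fun I => by
    obtain ⟨x, hx⟩ := hT _ I
    exact T.exists_mem_liftRel hj (hX.connected _ I) x hx _
  choose f hf using hs
  have hm : ∀ I, ∃ b, ((ℓ - cechD _ X k f) I, b) ∈ (T.inclRel j hj).on (cap X I) := fun I => by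
    obtain ⟨x, hx⟩ := hT _ I
    refine T.exists_mem_inclRel hj (hX.connected _ I) x hx ?_
    simpa using sub_mem (h1 I) ((T.liftRel j hj).cechD_mem_on hf I)
  choose m hm using hm
  refine ⟨m, ?_⟩
  funext I
  obtain ⟨x, hx⟩ := hT _ I
  refine sub_eq_zero.1 (T.eq_zero_of_mem_inclRel hj (hX.connected _ I) x hx ?_)
  have := sub_mem ((T.inclRel j hj).cechD_mem_on hm I) (h2 I)
  rw [map_sub, cechD_comp_cechD, sub_zero] at this
  simpa using this

namespace Choices

variable {c : ∀ j, CechCochain (L j).obj X (j + 2)} (E : T.Choices X c)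
include E

/-- The choices give objects only for tuples of length `j + 3`. For other lengths the object of a
constant tuple is restricted along the first projection followed by the diagonal. -/
theorem hasObjects (hj : j + 2 ≤ n) : T.HasObjects X j := by
  intro k I
  let K : Fin (j + 3) → ι := fun _ => I 0
  obtain ⟨x, -, hx, -⟩ := T.exists_restriction j hj (E.obj j hj K)
    (V := cap X I) ((Pi.lift fun _ => Pi.π _ 0) ≫ eqToHom (E.obj_over j hj K).symm)
  exact ⟨x, hx⟩

theorem isConnecting (hj : j + 3 ≤ n) : T.IsConnecting X j hj (c j) (c (j + 1)) := by
  refine ⟨E.lift j, fun K => ?_, fun I => ?_⟩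
  -- `lift_spec` concerns only restrictions to products with one more factor. Writing `K` as a face
  -- of a degenerate tuple and pulling back along the section `s` gives the relation over `X_K`
  -- itself.
  · obtain ⟨I, r, rfl, s, hs⟩ := exists_succAbove_comp_eq X K
    have := (T.liftRel j hj).mem_on_of_rel (by omega) (U := cap X I) (E.obj (j + 1) hj I)
      (eqToHom (E.obj_over (j + 1) hj I)) (E.lift_spec j hj I r)
    have := (T.liftRel j hj).res_mem_on s this
    change (res _ s (res _ (capMap X I r.succAbove) _), res _ s (res _ (capMap X I r.succAbove) _))
      ∈ _ at this
    rwa [← res_comp, ← res_comp, hs, res_id, res_id] at this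
  · exact (T.inclRel j hj).mem_on_of_rel (by omega) (U := cap X I) (E.obj (j + 1) hj I)
      (eqToHom (E.obj_over (j + 1) hj I)) (E.c_succ j hj I).symm

end Choices

end Connecting

end AbelianTower

end TorsorTower

end

noncomputable section

namespace TorsorTower

open AbelianTower

/-! ### Images of the connecting relation under morphisms of towers -/

namespace BaseMap

variable {C : Type u} [Category.{v} C] {J : GrothendieckTopology C}
  {L : ℕ → Sheaf J AddCommGrpCat.{w}} (b : BaseMap J L)

/-- The identification of the bands on sections. -/
def bandMap (j : ℕ) (U : C) : (L j).obj.obj (op U) →+ (L j).obj.obj (op (b.functor.obj U)) :=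
  ((b.band j).hom.app (op U)).hom

theorem bandMap_res (j : ℕ) {U V : C} (f : V ⟶ U) (a : (L j).obj.obj (op U)) :
    b.bandMap j V (res _ f a) = res _ (b.functor.map f) (b.bandMap j U a) :=
  ConcreteCategory.congr_hom ((b.band j).hom.naturality f.op) a

variable [HasFiniteProducts C] {ι : Type t} {X : ι → C}

theorem cochainMap_eq_iff {j k : ℕ} {c : CechCochain (L j).obj X k}
    {c' : CechCochain (L j).obj (fun i => b.functor.obj (X i)) k} :
    b.cochainMap j X k c' = c ↔ ∀ I, res _ (piComparison b.functor fun r => X (I r)) (c' I) =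
      b.bandMap j _ (c I) := by
  rw [funext_iff]
  refine forall_congr' fun I => ?_
  have h1 : ∀ a, b.bandMap j (cap X I) ((b.band j).inv.app (op (cap X I)) a) = a := fun a =>
    ConcreteCategory.congr_hom ((b.band j).inv_hom_id_app (op (cap X I))) a
  have h2 : ∀ a, (b.band j).inv.app (op (cap X I)) (b.bandMap j (cap X I) a) = a := fun a =>
    ConcreteCategory.congr_hom ((b.band j).hom_inv_id_app (op (cap X I))) a
  constructor
  · intro h
    rw [← h]
    exact (h1 _).symm
  · intro h
    exact (congrArg _ h).trans (h2 _)

theorem piComparison_capMap {k l : ℕ} (I : Fin k → ι) (e : Fin l → Fin k) :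
    b.functor.map (capMap X I e) ≫ piComparison b.functor (fun s => X ((I ∘ e) s)) =
      piComparison b.functor (fun r => X (I r)) ≫ capMap (fun i => b.functor.obj (X i)) I e := by
  apply Pi.hom_ext
  intro s
  simp [capMap]

end BaseMap

namespace TowerHom

variable {C : Type u} [Category.{v} C] {J : GrothendieckTopology C}
  {L : ℕ → Sheaf J AddCommGrpCat.{w}} {n : ℕ} {T T' : AbelianTower.{w, v, u, v₂, u₂} J L n}
  (f : TowerHom T T')

/-- The identification of the projection of `u(x)` with the image by `u₁` of the projection
of `x`. -/
def comparison {j : ℕ} (hj : j + 2 ≤ n) (x : T.F j) :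
    (T'.π j).obj ((f.u j hj).obj x) ⟶ f.base.functor.obj ((T.π j).obj x) :=
  eqToHom (Functor.congr_obj (f.comm_base j hj) x)

instance {j : ℕ} (hj : j + 2 ≤ n) (x : T.F j) : IsIso (f.comparison hj x) := by
  unfold comparison; infer_instance

theorem comparison_naturality {j : ℕ} (hj : j + 2 ≤ n) {x y : T.F j} (φ : x ⟶ y) :
    (T'.π j).map ((f.u j hj).map φ) ≫ f.comparison hj y =
      f.comparison hj x ≫ f.base.functor.map ((T.π j).map φ) := by
  have := Functor.congr_hom (f.comm_base j hj) φ
  simp only [Functor.comp_map] at this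
  simp [this, comparison]

theorem map_aut {j : ℕ} (hj : j + 2 ≤ n) (x : T.F j) (a) :
    (f.u j hj).map (T.aut x a) =
      T'.aut ((f.u j hj).obj x) (res _ (f.comparison hj x) (f.base.bandMap j _ a)) :=
  f.map_act j hj x a

/-- A morphism of towers maps the action of a section of `L'` to the action of another one. -/
def pushRel (j : ℕ) (hj : j + 3 ≤ n) :
    T.StableRel (j + 1) (T.L' j).obj (f.base.functor.op ⋙ (T'.L' j).obj) where
  rel x :=
    { carrier := {q | (f.u (j + 1) hj).map (T.aut' x q.1) =
        T'.aut' _ (res (T'.L' j).obj (f.comparison hj x) q.2)}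
      zero_mem' := by
        change (f.u (j + 1) hj).map (T.aut' x 0) =
          T'.aut' _ (res (T'.L' j).obj (f.comparison hj x) 0)
        rw [map_zero, aut'_zero, aut'_zero, CategoryTheory.Functor.map_id]
      add_mem' := fun {q q'} h h' => by
        change (f.u (j + 1) hj).map (T.aut' x (q.1 + q'.1)) =
          T'.aut' _ (res (T'.L' j).obj (f.comparison hj x) (q.2 + q'.2))
        rw [map_add, aut'_add, aut'_add, Functor.map_comp]
        exact congrArg₂ (· ≫ ·) h h'
      neg_mem' := fun {q} h => by
        change (f.u (j + 1) hj).map (T.aut' x (-q.1)) =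
          T'.aut' _ (res (T'.L' j).obj (f.comparison hj x) (-q.2))
        change (f.u (j + 1) hj).map (T.aut' x q.1) = _ at h
        simp only [map_neg, aut'_neg, Functor.map_inv, h] }
  res_mem {x y} φ a b h := by
    change (f.u (j + 1) hj).map (T.aut' x _) = T'.aut' _ (res (T'.L' j).obj (f.comparison hj x)
      (res (T'.L' j).obj (f.base.functor.map ((T.π (j + 1)).map φ)) b))
    change (f.u (j + 1) hj).map (T.aut' y a) = T'.aut' _ _ at h
    refine T'.hom_ext_of_comp hj ((f.u (j + 1) hj).map φ) ?_ ?_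
    · rw [T'.π_map_aut' hj]
      have := f.comparison_naturality hj (T.aut' x (res _ ((T.π (j + 1)).map φ) a))
      rw [T.π_map_aut' hj, CategoryTheory.Functor.map_id, Category.comp_id] at this
      rw [← cancel_mono (f.comparison hj x), this, Category.id_comp]
    · rw [← Functor.map_comp, T.aut'_comp hj φ, Functor.map_comp, h, ← T'.aut'_comp hj,
        ← res_comp, ← res_comp, comparison_naturality]

theorem mem_pushRel {j : ℕ} {hj : j + 3 ≤ n} {x : T.F (j + 1)} {a b} :
    (a, b) ∈ (f.pushRel j hj).rel x ↔ (f.u (j + 1) hj).map (T.aut' x a) =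
        T'.aut' _ (res (T'.L' j).obj (f.comparison hj x) b) := Iff.rfl

/-- A morphism of towers carries no map between the sheaves `L'`. Its compatibility with the functor
`p` and with the action of `L j` controls the image of an `L'`-automorphism one level below, which
is enough to transport lifts. -/
theorem p_map_map_aut' {j : ℕ} (hj : j + 3 ≤ n) (x : T.F (j + 1)) {a b}
    (h : (a, b) ∈ (T.liftRel j hj).rel x) :
    (T'.p j).map ((f.u (j + 1) hj).map (T.aut' x a)) =
      T'.autBelow ((f.u (j + 1) hj).obj x) (res _ (f.comparison hj x) (f.base.bandMap j _ b)) := by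
  rw [mem_liftRel] at h
  have hx : (T'.p j).obj ((f.u (j + 1) hj).obj x) = (f.u j (by omega)).obj ((T.p j).obj x) :=
    Functor.congr_obj (f.comm j hj (by omega)) x
  have e := Functor.congr_hom (f.comm j hj (by omega)) (T.aut' x a)
  simp only [Functor.comp_map] at e
  have h1 : (f.u j (by omega)).map (T.autBelow x b) =
      T'.aut _ (res _ (f.comparison (by omega) ((T.p j).obj x)) (f.base.bandMap j _ b)) :=
    f.map_aut (by omega) ((T.p j).obj x) b
  have h2 : (T'.π j).map (eqToHom hx) ≫ f.comparison (by omega) ((T.p j).obj x) =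
      f.comparison hj x := by
    simp only [comparison, eqToHom_map]
    exact eqToHom_trans _ _
  have h3 := T'.aut_comp (by omega) (eqToHom hx)
    (res _ (f.comparison (by omega) ((T.p j).obj x)) (f.base.bandMap j _ b))
  rw [← res_comp, h2, ← h1] at h3
  rw [e, h, ← Category.assoc, ← h3, Category.assoc, eqToHom_trans, eqToHom_refl,
    Category.comp_id]
  rfl

/-- Every lift of a section of `L` is mapped to a lift of its image. -/
theorem exists_mem_pushRel {j : ℕ} (hj : j + 3 ≤ n) {U : C} (x : T.F (j + 1))
    (hU : T.IsConnected n U) (hx : (T.π (j + 1)).obj x = U) {a b}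
    (h : (a, b) ∈ (T.liftRel j hj).on U) :
    ∃ a', (a, a') ∈ (f.pushRel j hj).on U ∧
      (a', f.base.bandMap j U b) ∈ (T'.liftRel j hj).on (f.base.functor.obj U) := by
  subst hx
  have h1 := h x ⟨_, hU, ⟨Iso.refl _⟩⟩ (𝟙 _)
  simp only [res_id] at h1
  have h2 := f.p_map_map_aut' hj x h1
  obtain ⟨a'', ha''⟩ := T'.exists_aut' hj h2
  have h3 : res (T'.L' j).obj (f.comparison hj x) (res _ (inv (f.comparison hj x)) a'') = a'' := by
    rw [← res_comp, IsIso.hom_inv_id, res_id]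
  refine ⟨res _ (inv (f.comparison hj x)) a'', ?_, ?_⟩
  · refine (f.pushRel j hj).mem_on_of_rel hj x (𝟙 _) ?_
    rw [res_id, res_id, mem_pushRel, h3, ha'']
  · refine (T'.liftRel j hj).mem_on_of_rel hj ((f.u (j + 1) hj).obj x) (f.comparison hj x) ?_
    rw [mem_liftRel, h3, ha'', h2]

theorem mem_inclRel_of_mem_pushRel {j : ℕ} (hj : j + 3 ≤ n) {U : C} (x : T.F (j + 1))
    (hU : T.IsConnected n U) (hx : (T.π (j + 1)).obj x = U) {a a' b}
    (h : (a, b) ∈ (T.inclRel j hj).on U) (h' : (a, a') ∈ (f.pushRel j hj).on U) :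
    (a', f.base.bandMap (j + 1) U b) ∈ (T'.inclRel j hj).on (f.base.functor.obj U) := by
  subst hx
  have h1 := h x ⟨_, hU, ⟨Iso.refl _⟩⟩ (𝟙 _)
  have h2 := h' x ⟨_, hU, ⟨Iso.refl _⟩⟩ (𝟙 _)
  simp only [res_id] at h1 h2
  refine (T'.inclRel j hj).mem_on_of_rel hj ((f.u (j + 1) hj).obj x) (f.comparison hj x) ?_
  rw [mem_pushRel] at h2
  rw [mem_inclRel] at h1 ⊢
  rw [← h2, h1, map_aut]

variable [HasFiniteProducts C] {ι : Type t} {X : ι → C}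

/-- The lifts are transported by `pushRel` to sections over `u₁(X_I)`, then moved to the products of
the `u₁(X_i)` by the inverses of the comparison maps. -/
theorem isConnecting (hpc : ∀ (k : ℕ) (I : Fin k → ι),
      IsIso (piComparison f.base.functor fun r => X (I r)))
    (hX : T.IsGoodCover X) {j : ℕ} {hj : j + 3 ≤ n} (hT : T.HasObjects X (j + 1)) {k : ℕ}
    {c : CechCochain (L j).obj X k} {d : CechCochain (L (j + 1)).obj X (k + 1)}
    {c' : CechCochain (L j).obj (fun i => f.base.functor.obj (X i)) k}
    {d' : CechCochain (L (j + 1)).obj (fun i => f.base.functor.obj (X i)) (k + 1)}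
    (hc : f.base.cochainMap j X k c' = c) (hd : f.base.cochainMap (j + 1) X (k + 1) d' = d)
    (h : T.IsConnecting X j hj c d) :
    T'.IsConnecting (fun i => f.base.functor.obj (X i)) j hj c' d' := by
  rw [BaseMap.cochainMap_eq_iff] at hc hd
  obtain ⟨ℓ, h1, h2⟩ := h
  have hs : ∀ I, ∃ a', (ℓ I, a') ∈ (f.pushRel j hj).on (cap X I) ∧
      (a', f.base.bandMap j _ (c I)) ∈ (T'.liftRel j hj).on (f.base.functor.obj (cap X I)) :=
    fun I => by
      obtain ⟨x, hx⟩ := hT _ I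
      exact f.exists_mem_pushRel hj x (hX.connected _ I) hx (h1 I)
  choose ℓ' hℓ' hℓ'' using hs
  let s : ∀ {k : ℕ} (I : Fin k → ι), cap (fun i => f.base.functor.obj (X i)) I ⟶
    f.base.functor.obj (cap X I) := fun I => inv (piComparison f.base.functor fun r => X (I r))
  have hsc : ∀ {k : ℕ} (I : Fin k → ι) (j : ℕ) (a : (L j).obj.obj (op _)),
      res _ (s I) (res _ (piComparison f.base.functor fun r => X (I r)) a) = a := fun I j a => by
    rw [← res_comp, IsIso.inv_hom_id, res_id]
  refine ⟨fun I => res _ (s I) (ℓ' I), fun I => ?_, fun I => ?_⟩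
  · rw [← hsc I j (c' I), hc]
    exact (T'.liftRel j hj).res_mem_on (s I) (hℓ'' I)
  · rw [← hsc I (j + 1) (d' I), hd]
    obtain ⟨x, hx⟩ := hT _ I
    have h3 := f.mem_inclRel_of_mem_pushRel hj x (hX.connected _ I) hx (h2 I)
      ((f.pushRel j hj).cechD_mem_on hℓ' I)
    have h4 := (T'.inclRel j hj).res_mem_on (s I) h3
    -- The differential in `h4` is formed over the `u₁(X_I)`; naturality of `piComparison` for face
    -- maps identifies it with the Čech differential of the family `u₁(X_i)`.
    convert h4 using 2
    rw [cechD_apply, cechD_apply, map_sum]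
    refine Finset.sum_congr rfl fun r _ => ?_
    rw [map_zsmul]
    congr 1
    change _ = res _ (s I) (res (T'.L' j).obj (f.base.functor.map (capMap X I r.succAbove)) _)
    rw [← res_comp, ← res_comp]
    congr 2
    have := f.base.piComparison_capMap (X := X) I r.succAbove
    rw [IsIso.comp_inv_eq, Category.assoc, IsIso.eq_inv_comp]
    exact this.symm

end TowerHom

end TorsorTower

end

noncomputable section

namespace TorsorTower

open AbelianTower

/-! ### Transition data in the gerbe -/

namespace AbelianTower

variable {C : Type u} [Category.{v} C] {J : GrothendieckTopology C}
  {L : ℕ → Sheaf J AddCommGrpCat.{w}} {n : ℕ} {ι : Type t}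

/-- Objects `x_i` of the gerbe over the `X_i` with arrows `g_{ij}` from the restriction of `x_j` to
`X_{ij}` to the one of `x_i`, given by the operations `α ↦ g_{ij} α` on arrows into the `x_j`. -/
structure Transition (T : AbelianTower.{w, v, u, v₂, u₂} J L n) (X : ι → C) where
  /-- the objects -/
  x : ι → T.F 0
  /-- their projections -/
  q : ∀ i, (T.π 0).obj (x i) ⟶ X i
  isIso_q : ∀ i, IsIso (q i)
  /-- the operations -/
  G : ∀ (i k : ι) {z : T.F 0}, (z ⟶ x k) → ((T.π 0).obj z ⟶ X i) → (z ⟶ x i)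
  G_over : ∀ (i k : ι) {z : T.F 0} (α : z ⟶ x k) (f : (T.π 0).obj z ⟶ X i),
    (T.π 0).map (G i k α f) ≫ q i = f
  G_comp : ∀ (i k : ι) {z z' : T.F 0} (m : z' ⟶ z) (α : z ⟶ x k) (f : (T.π 0).obj z ⟶ X i),
    G i k (m ≫ α) ((T.π 0).map m ≫ f) = m ≫ G i k α f

attribute [instance] Transition.isIso_q

/-! ### Transition operations obtained from arrows -/

section Construction

variable {T : AbelianTower.{w, v, u, v₂, u₂} J L n} {X : ι → C}

/-- Objects over the products `X_i × X_k` with arrows to the `x_i` and `x_k`. -/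
structure TransitionArrows (T : AbelianTower.{w, v, u, v₂, u₂} J L n) (X : ι → C) where
  /-- the objects `x_i` -/
  x : ι → T.F 0
  /-- their projections -/
  q : ∀ i, (T.π 0).obj (x i) ⟶ X i
  isIso_q : ∀ i, IsIso (q i)
  /-- the objects over the products -/
  Q : ι → ι → T.F 0
  /-- the arrow to `x_k` -/
  src : ∀ i k, Q i k ⟶ x k
  /-- the arrow to `x_i` -/
  tgt : ∀ i k, Q i k ⟶ x i
  existsUnique_map : ∀ (i k : ι) {V : C} (f : V ⟶ X i) (g : V ⟶ X k),
    ∃! m : V ⟶ (T.π 0).obj (Q i k), m ≫ (T.π 0).map (src i k) ≫ q k = g ∧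
      m ≫ (T.π 0).map (tgt i k) ≫ q i = f

attribute [instance] TransitionArrows.isIso_q

namespace TransitionArrows

variable (A : TransitionArrows T X) (hn : 0 + 2 ≤ n)
include hn

theorem exists_factor (i k : ι) {z : T.F 0} (α : z ⟶ A.x k) (f : (T.π 0).obj z ⟶ X i) :
    ∃ χ : z ⟶ A.Q i k, χ ≫ A.src i k = α ∧ (T.π 0).map (χ ≫ A.tgt i k) ≫ A.q i = f := by
  obtain ⟨m, ⟨h1, h2⟩, -⟩ := A.existsUnique_map i k f ((T.π 0).map α ≫ A.q k)
  rw [← Category.assoc, cancel_mono] at h1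
  obtain ⟨χ, h3, h4⟩ := T.exists_lift hn (A.src i k) α m h1.symm
  exact ⟨χ, h4, by rw [Functor.map_comp, h3, Category.assoc, h2]⟩

/-- The operation `α ↦ g_{ik} α`. -/
def operation (i k : ι) {z : T.F 0} (α : z ⟶ A.x k) (f : (T.π 0).obj z ⟶ X i) : z ⟶ A.x i :=
  (A.exists_factor hn i k α f).choose ≫ A.tgt i k

/-- The factor through `Q i k` is unique, since its projection is determined by the product property
and `src` is cartesian. So any factor computes the operation. -/
theorem operation_eq {i k : ι} {z : T.F 0} {α : z ⟶ A.x k} {f : (T.π 0).obj z ⟶ X i}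
    (χ : z ⟶ A.Q i k) (h : χ ≫ A.src i k = α) (h' : (T.π 0).map (χ ≫ A.tgt i k) ≫ A.q i = f) :
    A.operation hn i k α f = χ ≫ A.tgt i k := by
  obtain ⟨h1, h2⟩ := (A.exists_factor hn i k α f).choose_spec
  have : (A.exists_factor hn i k α f).choose = χ := by
    refine T.hom_ext_of_comp hn (A.src i k) ?_ (h1.trans h.symm)
    refine (A.existsUnique_map i k f ((T.π 0).map α ≫ A.q k)).unique ⟨?_, ?_⟩ ⟨?_, ?_⟩
    · rw [← Category.assoc, ← Functor.map_comp, h1]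
    · rw [← Category.assoc, ← Functor.map_comp, h2]
    · rw [← Category.assoc, ← Functor.map_comp, h]
    · rw [← Category.assoc, ← Functor.map_comp, h']
  rw [operation, this]

/-- The transition data given by the arrows. -/
def transition : Transition T X where
  x := A.x
  q := A.q
  isIso_q := A.isIso_q
  G i k _ α f := A.operation hn i k α f
  G_over i k _ α f := (A.exists_factor hn i k α f).choose_spec.2
  G_comp i k _ _ m α f := by
    obtain ⟨χ, h1, h2⟩ := A.exists_factor hn i k α f
    rw [A.operation_eq hn χ h1 h2, A.operation_eq hn (m ≫ χ), Category.assoc]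
    · rw [Category.assoc, h1]
    · rw [Category.assoc, Functor.map_comp, Category.assoc, h2]

end TransitionArrows

end Construction

/-! ### The cochain of a system of transition arrows and its class -/

namespace Transition

variable {T : AbelianTower.{w, v, u, v₂, u₂} J L n} {X : ι → C} (E : T.Transition X)

theorem G_aut_comp (hn : 0 + 2 ≤ n) (i k : ι) {z : T.F 0} (α : z ⟶ E.x k)
    (f : (T.π 0).obj z ⟶ X i) (a) :
    E.G i k (T.aut z a ≫ α) f = T.aut z a ≫ E.G i k α f := by
  rw [← E.G_comp, T.π_map_aut hn, Category.id_comp]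

variable [HasFiniteProducts C]

theorem exists_universal (hn : 0 + 2 ≤ n) {k : ℕ} (I : Fin k → ι) (r : Fin k) :
    ∃ (t : T.F 0) (ht : (T.π 0).obj t = cap X I) (α : t ⟶ E.x (I r)),
      (T.π 0).map α ≫ E.q (I r) = eqToHom ht ≫ Pi.π (fun s => X (I s)) r := by
  obtain ⟨t, α, ht, h⟩ := T.exists_restriction 0 hn (E.x (I r))
    (Pi.π (fun s => X (I s)) r ≫ inv (E.q (I r)))
  exact ⟨t, ht, α, by simp [h]⟩

theorem exists_factor (hn : 0 + 2 ≤ n) {k : ℕ} {I : Fin k → ι} {r : Fin k} {t z : T.F 0}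
    {θ : (T.π 0).obj t ⟶ cap X I} [IsIso θ] {α₀ : t ⟶ E.x (I r)}
    (h₀ : (T.π 0).map α₀ ≫ E.q (I r) = θ ≫ Pi.π (fun s => X (I s)) r)
    {f : (T.π 0).obj z ⟶ cap X I} {α : z ⟶ E.x (I r)}
    (h : (T.π 0).map α ≫ E.q (I r) = f ≫ Pi.π (fun s => X (I s)) r) :
    ∃ m : z ⟶ t, (T.π 0).map m ≫ θ = f ∧ m ≫ α₀ = α := by
  obtain ⟨m, h1, h2⟩ := T.exists_lift hn α₀ α (f ≫ inv θ) (by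
    rw [← cancel_mono (E.q (I r)), h, Category.assoc, Category.assoc, h₀, IsIso.inv_hom_id_assoc])
  exact ⟨m, by simp [h1], h2⟩

/-- The cochain `c` is given by `g_{ij} g_{jk} = c_{ijk} g_{ik}`. -/
def IsClassifiedBy (c : CechCochain (L 0).obj X 2) : Prop :=
  ∀ (I : Fin 3 → ι) {z : T.F 0} (f : (T.π 0).obj z ⟶ cap X I) (α : z ⟶ E.x (I 2)),
    (T.π 0).map α ≫ E.q (I 2) = f ≫ Pi.π (fun s => X (I s)) 2 →
    E.G (I 0) (I 1) (E.G (I 1) (I 2) α (f ≫ Pi.π (fun s => X (I s)) 1))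
        (f ≫ Pi.π (fun s => X (I s)) 0) =
      T.aut z (res _ f (c I)) ≫ E.G (I 0) (I 2) α (f ≫ Pi.π (fun s => X (I s)) 0)

variable {E}

/-- An arrow to `x_{i₂}` with a compatible map to `X_I` factors through any object lying over `X_I`,
so the identity follows from a single instance by naturality of the operations and of the band. -/
theorem isClassifiedBy_of_exists (hn : 0 + 2 ≤ n) {c : CechCochain (L 0).obj X 2}
    (H : ∀ I : Fin 3 → ι, ∃ (t : T.F 0) (θ : (T.π 0).obj t ⟶ cap X I) (_ : IsIso θ)
      (α : t ⟶ E.x (I 2)), (T.π 0).map α ≫ E.q (I 2) = θ ≫ Pi.π (fun s => X (I s)) 2 ∧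
      E.G (I 0) (I 1) (E.G (I 1) (I 2) α (θ ≫ Pi.π (fun s => X (I s)) 1))
          (θ ≫ Pi.π (fun s => X (I s)) 0) =
        T.aut t (res _ θ (c I)) ≫ E.G (I 0) (I 2) α (θ ≫ Pi.π (fun s => X (I s)) 0)) :
    E.IsClassifiedBy c := by
  intro I z f α hα
  obtain ⟨t, θ, _, α₀, h₀, h⟩ := H I
  obtain ⟨m, rfl, rfl⟩ := E.exists_factor hn h₀ hα
  simp only [Category.assoc, G_comp]
  rw [h, res_comp, ← Category.assoc, ← T.aut_comp hn m, Category.assoc]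

theorem IsClassifiedBy.comp {c : CechCochain (L 0).obj X 2} (hc : E.IsClassifiedBy c) {k : ℕ}
    {I : Fin k → ι} (e : Fin 3 → Fin k) {z : T.F 0} (f : (T.π 0).obj z ⟶ cap X I)
    (α : z ⟶ E.x (I (e 2)))
    (h : (T.π 0).map α ≫ E.q (I (e 2)) = f ≫ Pi.π (fun s => X (I s)) (e 2)) :
    E.G (I (e 0)) (I (e 1)) (E.G (I (e 1)) (I (e 2)) α (f ≫ Pi.π (fun s => X (I s)) (e 1)))
        (f ≫ Pi.π (fun s => X (I s)) (e 0)) =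
      T.aut z (res _ f (res _ (capMap X I e) (c (I ∘ e)))) ≫
        E.G (I (e 0)) (I (e 2)) α (f ≫ Pi.π (fun s => X (I s)) (e 0)) := by
  have hf : ∀ s, (f ≫ capMap X I e) ≫ Pi.π (fun s => X ((I ∘ e) s)) s =
      f ≫ Pi.π (fun s => X (I s)) (e s) := fun s => by rw [Category.assoc, capMap_π]
  have := hc (I ∘ e) (f ≫ capMap X I e) α (h.trans (hf 2).symm)
  rw [hf, hf, res_comp] at this
  exact this

/-- Evaluate `g₀₁ g₁₂ g₂₃` in two ways: contracting `g₁₂ g₂₃` first gives `a 0 + a 2`, contracting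
`g₀₁ g₁₂` first gives `a 3 + a 1`, both times `g₀₃`. -/
theorem IsClassifiedBy.cechD_eq_zero (hn : 0 + 2 ≤ n) {c : CechCochain (L 0).obj X 2}
    (hc : E.IsClassifiedBy c) : cechD _ X 2 c = 0 := by
  funext I
  obtain ⟨z, hz, α, hα⟩ := E.exists_universal hn I 3
  set f : (T.π 0).obj z ⟶ cap X I := eqToHom hz with hf
  set a : Fin 4 → (L 0).obj.obj (op ((T.π 0).obj z)) := fun r =>
    res _ f (res _ (capMap X I r.succAbove) (c (I ∘ r.succAbove))) with ha
  set p : ∀ r, (T.π 0).obj z ⟶ X (I r) := fun r => f ≫ Pi.π (fun s => X (I s)) r with hp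
  let β : z ⟶ E.x (I 2) := E.G (I 2) (I 3) α (p 2)
  have h0 : E.G (I 1) (I 2) β (p 1) = T.aut z (a 0) ≫ E.G (I 1) (I 3) α (p 1) :=
    hc.comp (Fin.succAbove 0) f α hα
  have h1 : E.G (I 0) (I 2) β (p 0) = T.aut z (a 1) ≫ E.G (I 0) (I 3) α (p 0) :=
    hc.comp (Fin.succAbove 1) f α hα
  have h2 : E.G (I 0) (I 1) (E.G (I 1) (I 3) α (p 1)) (p 0) =
      T.aut z (a 2) ≫ E.G (I 0) (I 3) α (p 0) :=
    hc.comp (Fin.succAbove 2) f α hα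
  have h3 : E.G (I 0) (I 1) (E.G (I 1) (I 2) β (p 1)) (p 0) =
      T.aut z (a 3) ≫ E.G (I 0) (I 2) β (p 0) :=
    hc.comp (Fin.succAbove 3) f β (E.G_over _ _ _ _)
  rw [h0, E.G_aut_comp hn, h2, h1, ← Category.assoc, ← Category.assoc, ← aut_add, ← aut_add] at h3
  have h4 := T.aut_cancel hn _ h3
  have h5 : res _ f (cechD _ X 2 c I) = a 0 - a 1 + a 2 - a 3 := by
    rw [cechD_apply, map_sum]
    simp only [map_zsmul]
    rw [Fin.sum_univ_four]
    simp [ha]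
    abel
  have h6 : res _ f (cechD _ X 2 c I) = 0 := by
    rw [h5, show a 0 - a 1 + a 2 - a 3 = (a 0 + a 2) - (a 3 + a 1) by abel, h4, sub_self]
  have h7 := congrArg (res _ (inv f)) h6
  rwa [← res_comp, IsIso.inv_hom_id, res_id, map_zero] at h7

/-- The classes of two cochains that classify the same gerbe coincide. -/
theorem IsClassifiedBy.exists_sub_eq (hn : 0 + 2 ≤ n) (hX : ∀ i, T.Conn (X i))
    {c c' : CechCochain (L 0).obj X 2} (hc : E.IsClassifiedBy c) {E' : T.Transition X}
    (hc' : E'.IsClassifiedBy c') : ∃ e, cechD _ X 1 e = c' - c := by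
  -- Connectedness of `X_i` gives `h_i : x_i ⟶ x'_i`; the cochain `e` will measure the failure of
  -- the `h_i` to commute with the transitions, `g'_{ik} h_k = e_{ik} h_i g_{ik}`.
  have hh : ∀ i, ∃ h : E.x i ⟶ E'.x i, (T.π 0).map h ≫ E'.q i = E.q i := fun i => by
    obtain ⟨h, hi⟩ := T.exists_arrow hn ((hX i).of_iso (asIso (E.q i))) (E.q i ≫ inv (E'.q i))
    exact ⟨h, by simp [hi]⟩
  choose h hh using hh
  have he : ∀ I : Fin 2 → ι, ∃ ε : (L 0).obj.obj (op (cap X I)), ∀ {z : T.F 0}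
      (f : (T.π 0).obj z ⟶ cap X I) (α : z ⟶ E.x (I 1)),
      (T.π 0).map α ≫ E.q (I 1) = f ≫ Pi.π (fun s => X (I s)) 1 →
      E'.G (I 0) (I 1) (α ≫ h (I 1)) (f ≫ Pi.π (fun s => X (I s)) 0) =
        T.aut z (res _ f ε) ≫ E.G (I 0) (I 1) α (f ≫ Pi.π (fun s => X (I s)) 0) ≫ h (I 0) := by
    intro I
    obtain ⟨t, ht, α₀, h₀⟩ := E.exists_universal hn I 1
    set θ : (T.π 0).obj t ⟶ cap X I := eqToHom ht
    obtain ⟨a, ha⟩ := T.exists_aut_comp hn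
      (E'.G (I 0) (I 1) (α₀ ≫ h (I 1)) (θ ≫ Pi.π (fun s => X (I s)) 0))
      (E.G (I 0) (I 1) α₀ (θ ≫ Pi.π (fun s => X (I s)) 0) ≫ h (I 0)) (by
        rw [← cancel_mono (E'.q (I 0)), E'.G_over, Functor.map_comp, Category.assoc, hh, E.G_over])
    refine ⟨res _ (inv θ) a, fun {z} f α hα => ?_⟩
    obtain ⟨m, rfl, rfl⟩ := E.exists_factor hn h₀ hα
    simp only [Category.assoc, G_comp, ha]
    rw [← res_comp, Category.assoc, IsIso.hom_inv_id, Category.comp_id, ← Category.assoc,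
      ← T.aut_comp hn m, Category.assoc]
  choose e he using he
  have he' : ∀ {I : Fin 3 → ι} (s : Fin 2 → Fin 3) {z : T.F 0} (f : (T.π 0).obj z ⟶ cap X I)
      (α : z ⟶ E.x (I (s 1))),
      (T.π 0).map α ≫ E.q (I (s 1)) = f ≫ Pi.π (fun s => X (I s)) (s 1) →
      E'.G (I (s 0)) (I (s 1)) (α ≫ h (I (s 1))) (f ≫ Pi.π (fun s => X (I s)) (s 0)) =
        T.aut z (res _ f (res _ (capMap X I s) (e (I ∘ s)))) ≫
          E.G (I (s 0)) (I (s 1)) α (f ≫ Pi.π (fun s => X (I s)) (s 0)) ≫ h (I (s 0)) := by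
    intro I s z f α hα
    have hf : ∀ r, (f ≫ capMap X I s) ≫ Pi.π (fun r => X ((I ∘ s) r)) r =
      f ≫ Pi.π (fun r => X (I r)) (s r) := fun r => by rw [Category.assoc, capMap_π]
    have := he (I ∘ s) (f ≫ capMap X I s) α (hα.trans (hf 1).symm)
    rw [hf, res_comp] at this
    exact this
  refine ⟨e, ?_⟩
  funext I
  obtain ⟨z, hz, α, hα⟩ := E.exists_universal hn I 2
  set f : (T.π 0).obj z ⟶ cap X I := eqToHom hz with hf
  set a : Fin 3 → (L 0).obj.obj (op ((T.π 0).obj z)) := fun r =>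
    res _ f (res _ (capMap X I r.succAbove) (e (I ∘ r.succAbove))) with ha
  set p : ∀ r, (T.π 0).obj z ⟶ X (I r) := fun r => f ≫ Pi.π (fun s => X (I s)) r with hp
  have h0 : E'.G (I 1) (I 2) (α ≫ h (I 2)) (p 1) =
      T.aut z (a 0) ≫ E.G (I 1) (I 2) α (p 1) ≫ h (I 1) := he' (Fin.succAbove 0) f α hα
  have h1 : E'.G (I 0) (I 2) (α ≫ h (I 2)) (p 0) =
      T.aut z (a 1) ≫ E.G (I 0) (I 2) α (p 0) ≫ h (I 0) := he' (Fin.succAbove 1) f α hα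
  have h2 : E'.G (I 0) (I 1) (E.G (I 1) (I 2) α (p 1) ≫ h (I 1)) (p 0) =
      T.aut z (a 2) ≫ E.G (I 0) (I 1) (E.G (I 1) (I 2) α (p 1)) (p 0) ≫ h (I 0) :=
    he' (Fin.succAbove 2) f _ (E.G_over _ _ _ _)
  have h3 := hc' I f (α ≫ h (I 2)) (by rw [Functor.map_comp, Category.assoc, hh, hα])
  have h4 := hc I f α hα
  change E'.G (I 0) (I 1) (E'.G (I 1) (I 2) (α ≫ h (I 2)) (p 1)) (p 0) =
    T.aut z _ ≫ E'.G (I 0) (I 2) (α ≫ h (I 2)) (p 0) at h3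
  change E.G (I 0) (I 1) (E.G (I 1) (I 2) α (p 1)) (p 0) =
    T.aut z _ ≫ E.G (I 0) (I 2) α (p 0) at h4
  rw [h0, E'.G_aut_comp hn, h2, h4, h1] at h3
  simp only [← Category.assoc, ← aut_add] at h3
  simp only [Category.assoc] at h3
  -- Computing `g'₀₁ g'₁₂ h₂` through `e` and `c`, and through `c'` and `e`, gives `a 0 + a 2 + c =
  -- c' + a 1`.
  have h5 := T.aut_cancel hn _ h3
  have h6 : res _ f (cechD _ X 1 e I) = a 0 - a 1 + a 2 := by
    rw [cechD_apply, map_sum]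
    simp only [map_zsmul]
    rw [Fin.sum_univ_three]
    simp [ha]
    abel
  have h7 : res _ f (cechD _ X 1 e I) = res _ f ((c' - c) I) := by
    rw [h6, Pi.sub_apply, map_sub, eq_sub_iff_add_eq]
    rw [show a 0 - a 1 + a 2 + res _ f (c I) = (a 0 + a 2 + res _ f (c I)) - a 1 by abel,
      sub_eq_iff_eq_add, ← h5]
    abel
  have h8 := congrArg (res _ (inv f)) h7
  rwa [← res_comp, ← res_comp, IsIso.inv_hom_id, res_id, res_id] at h8

end Transition

end AbelianTower

end TorsorTower

end

noncomputable section

namespace TorsorTower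

open AbelianTower

/-! ### Transition data given by the choices -/

/-- The identity morphism of a tower. -/
def TowerHom.refl {C : Type u} [Category.{v} C] {J : GrothendieckTopology C}
    {L : ℕ → Sheaf J AddCommGrpCat.{w}} {n : ℕ} (T : AbelianTower.{w, v, u, v₂, u₂} J L n) :
    TowerHom T T where
  base := BaseMap.refl J L
  u _ _ := 𝟭 _
  comm₂ _ := rfl
  comm _ _ _ := rfl
  comm_base _ _ := rfl
  map_act j _ x a := by
    change T.aut x a = T.aut x (res _ (𝟙 _) a)
    rw [res_id]

section

variable {C : Type u} [Category.{v} C] [HasFiniteProducts C] {ι : Type t}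

theorem existsUnique_cap_two (X : ι → C) (I : Fin 2 → ι) {V : C} (f : V ⟶ X (I 0))
    (g : V ⟶ X (I 1)) : ∃! m : V ⟶ cap X I,
      m ≫ Pi.π (fun r => X (I r)) 1 = g ∧ m ≫ Pi.π (fun r => X (I r)) 0 = f := by
  refine ⟨Pi.lift fun | 0 => f | 1 => g, ⟨Pi.lift_π _ _, Pi.lift_π _ _⟩, fun m hm => ?_⟩
  apply Pi.hom_ext
  intro r
  rw [Pi.lift_π]
  match r with
  | 0 => exact hm.2
  | 1 => exact hm.1

theorem existsUnique_of_iso_cap {X : ι → C} {I : Fin 2 → ι} {P : C} (θ : P ⟶ cap X I) [IsIso θ]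
    {s : P ⟶ X (I 1)} {t : P ⟶ X (I 0)} (hs : s = θ ≫ Pi.π (fun r => X (I r)) 1)
    (ht : t = θ ≫ Pi.π (fun r => X (I r)) 0) {V : C} (f : V ⟶ X (I 0)) (g : V ⟶ X (I 1)) :
    ∃! m : V ⟶ P, m ≫ s = g ∧ m ≫ t = f := by
  subst hs ht
  obtain ⟨m, ⟨h3, h4⟩, h5⟩ := existsUnique_cap_two X I f g
  refine ⟨m ≫ inv θ, ⟨by simpa using h3, by simpa using h4⟩, fun m' hm' => ?_⟩
  rw [IsIso.eq_comp_inv]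
  exact h5 _ ⟨by simpa using hm'.1, by simpa using hm'.2⟩

theorem piComparison_id (X : ι → C) {k : ℕ} (I : Fin k → ι) :
    piComparison (𝟭 C) (fun r => X (I r)) = 𝟙 (cap X I) := by
  apply Pi.hom_ext
  intro s
  rw [piComparison_comp_π]
  exact (Category.id_comp _).symm

end

namespace AbelianTower.Choices

variable {C : Type u} [Category.{v} C] [HasFiniteProducts C] {J : GrothendieckTopology C}
  {L : ℕ → Sheaf J AddCommGrpCat.{w}} {n : ℕ} {ι : Type t}
  {T : AbelianTower.{w, v, u, v₂, u₂} J L n} {X : ι → C}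
  {c : ∀ j, CechCochain (L j).obj X (j + 2)} (E : T.Choices X c)

/-- The projection of `x_i`. -/
def q (i : ι) : (T.π 0).obj (E.x i) ⟶ X i := eqToHom (E.x_over i)

theorem y_over {k : ℕ} (I : Fin k → ι) (r : Fin k) : (T.π 0).obj (E.y I r) = cap X I :=
  @IsHomLift.domain_eq _ _ _ _ T.p₂ _ _ _ _ _ _ (E.ρ_cart I r).toIsHomLift

/-- The projection of the restriction of `x_{i_r}` to `X_I`. -/
def τ {k : ℕ} (I : Fin k → ι) (r : Fin k) : (T.π 0).obj (E.y I r) ⟶ cap X I :=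
  eqToHom (E.y_over I r)

instance (i : ι) : IsIso (E.q i) := (eqToIso (E.x_over i)).isIso_hom

instance {k : ℕ} (I : Fin k → ι) (r : Fin k) : IsIso (E.τ I r) := (eqToIso (E.y_over I r)).isIso_hom

theorem map_ρ {k : ℕ} (I : Fin k → ι) (r : Fin k) :
    (T.π 0).map (E.ρ I r) ≫ E.q (I r) = E.τ I r ≫ Pi.π (fun s => X (I s)) r :=
  map_eq_of_isHomLift _ (E.ρ_cart I r).toIsHomLift (E.y_over I r) (E.x_over (I r))

theorem map_g (i k : ι) : (T.π 0).map (E.g i k) ≫ E.τ ![i, k] 0 = E.τ ![i, k] 1 :=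
  (map_eq_of_isHomLift _ (E.g_over i k) (E.y_over _ _) (E.y_over _ _)).trans (Category.comp_id _)

theorem map_γ (I : Fin 3 → ι) (a b : Fin 3) :
    (T.π 0).map (E.γ I a b) ≫ E.τ I a = E.τ I b :=
  (map_eq_of_isHomLift _ (E.γ_over I a b) (E.y_over _ _) (E.y_over _ _)).trans (Category.comp_id _)

variable {T' : AbelianTower.{w, v, u, v₂, u₂} J L n} (f : TowerHom T T') (hn : 0 + 2 ≤ n)

/-- The projection of the image of `x_i`. -/
def imageQ (i : ι) : (T'.π 0).obj ((f.u 0 hn).obj (E.x i)) ⟶ f.base.functor.obj (X i) :=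
  f.comparison hn (E.x i) ≫ f.base.functor.map (E.q i)

/-- The projection of the image of the restriction of `x_{i_r}` to `X_I`. -/
def imageτ {k : ℕ} (I : Fin k → ι) (r : Fin k) : (T'.π 0).obj ((f.u 0 hn).obj (E.y I r)) ⟶
    cap (fun i => f.base.functor.obj (X i)) I :=
  f.comparison hn _ ≫ f.base.functor.map (E.τ I r) ≫ piComparison f.base.functor fun r => X (I r)

instance (i : ι) : IsIso (E.imageQ f hn i) := by unfold imageQ; infer_instance

theorem map_map_ρ {k : ℕ} (I : Fin k → ι) (r : Fin k) :
    (T'.π 0).map ((f.u 0 hn).map (E.ρ I r)) ≫ E.imageQ f hn (I r) =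
      E.imageτ f hn I r ≫ Pi.π (fun s => f.base.functor.obj (X (I s))) r := by
  rw [imageQ, ← Category.assoc, f.comparison_naturality, Category.assoc, ← Functor.map_comp, map_ρ,
    imageτ, Category.assoc, Category.assoc, piComparison_comp_π, Functor.map_comp]

theorem map_map_g (i k : ι) : (T'.π 0).map ((f.u 0 hn).map (E.g i k)) ≫ E.imageτ f hn ![i, k] 0 =
    E.imageτ f hn ![i, k] 1 := by
  rw [imageτ, ← Category.assoc, f.comparison_naturality, Category.assoc, ← Category.assoc
    (f.base.functor.map _) (f.base.functor.map _), ← Functor.map_comp, map_g, imageτ]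

theorem map_map_γ (I : Fin 3 → ι) (a b : Fin 3) :
    (T'.π 0).map ((f.u 0 hn).map (E.γ I a b)) ≫ E.imageτ f hn I a = E.imageτ f hn I b := by
  rw [imageτ, ← Category.assoc, f.comparison_naturality, Category.assoc, ← Category.assoc
    (f.base.functor.map _) (f.base.functor.map _), ← Functor.map_comp, map_γ, imageτ]

variable (hpc : ∀ (k : ℕ) (I : Fin k → ι), IsIso (piComparison f.base.functor fun r => X (I r)))
include hpc

theorem isIso_imageτ {k : ℕ} (I : Fin k → ι) (r : Fin k) : IsIso (E.imageτ f hn I r) := by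
  unfold imageτ; infer_instance

/-- The images of the objects and arrows of the gerbe under a morphism of towers. -/
def transitionArrows : TransitionArrows T' fun i => f.base.functor.obj (X i) where
  x i := (f.u 0 hn).obj (E.x i)
  q i := E.imageQ f hn i
  isIso_q i := inferInstance
  Q i k := (f.u 0 hn).obj (E.y ![i, k] 1)
  src i k := (f.u 0 hn).map (E.ρ ![i, k] 1)
  tgt i k := (f.u 0 hn).map (E.g i k ≫ E.ρ ![i, k] 0)
  existsUnique_map i k V a b := by
    have := E.isIso_imageτ f hn hpc ![i, k] 1
    refine existsUnique_of_iso_cap (X := fun i => f.base.functor.obj (X i)) (I := ![i, k])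
      (E.imageτ f hn ![i, k] 1) (E.map_map_ρ f hn ![i, k] 1) ?_ a b
    have := E.map_map_ρ f hn ![i, k] 0
    refine Eq.trans ?_ (congrArg ((T'.π 0).map ((f.u 0 hn).map (E.g i k)) ≫ ·) this |>.trans ?_)
    · rw [← Category.assoc, ← Functor.map_comp, ← Functor.map_comp]
      rfl
    · rw [← Category.assoc, map_map_g]

/-- The arrow `s` of `γ_restrict` supplies the factor through the object over the double product, so
the operation is computed by the chosen restriction `γ` of `g`. -/
theorem G_map_ρ (I : Fin 3 → ι) (a b : Fin 3) :
    ((E.transitionArrows f hn hpc).transition hn).G (I a) (I b) ((f.u 0 hn).map (E.ρ I b))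
        (E.imageτ f hn I b ≫ Pi.π (fun s => f.base.functor.obj (X (I s))) a) =
      (f.u 0 hn).map (E.γ I a b) ≫ (f.u 0 hn).map (E.ρ I a) := by
  obtain ⟨s, s', h1, h2, h3⟩ := E.γ_restrict I a b
  have h4 : (f.u 0 hn).map s ≫ (f.u 0 hn).map (E.g (I a) (I b) ≫ E.ρ ![I a, I b] 0) =
      (f.u 0 hn).map (E.γ I a b) ≫ (f.u 0 hn).map (E.ρ I a) := by
    rw [← Functor.map_comp, ← Functor.map_comp]
    refine congrArg (f.u 0 hn).map ((Category.assoc _ _ _).symm.trans ?_)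
    rw [h3]
    exact (Category.assoc _ _ _).trans (congrArg (E.γ I a b ≫ ·) h2)
  refine ((E.transitionArrows f hn hpc).operation_eq hn ((f.u 0 hn).map s) ?_ ?_).trans h4
  · exact ((f.u 0 hn).map_comp _ _).symm.trans (congrArg (f.u 0 hn).map h1)
  · refine (congrArg (fun m => (T'.π 0).map m ≫ E.imageQ f hn (I a)) h4).trans ?_
    rw [Functor.map_comp, Category.assoc, map_map_ρ, ← Category.assoc, map_map_γ]

/-- The transition data given by the choices are classified by the first classifying cochain. -/
theorem isClassifiedBy {c' : CechCochain (L 0).obj (fun i => f.base.functor.obj (X i)) 2}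
    (hc : f.base.cochainMap 0 X 2 c' = c 0) :
    ((E.transitionArrows f hn hpc).transition hn).IsClassifiedBy c' := by
  rw [BaseMap.cochainMap_eq_iff] at hc
  refine Transition.isClassifiedBy_of_exists hn fun I => ?_
  refine ⟨(f.u 0 hn).obj (E.y I 2), E.imageτ f hn I 2, E.isIso_imageτ f hn hpc I 2,
    (f.u 0 hn).map (E.ρ I 2), E.map_map_ρ f hn I 2, ?_⟩
  have h1 := ((E.transitionArrows f hn hpc).transition hn).G_comp (I 0) (I 1)
    ((f.u 0 hn).map (E.γ I 1 2)) ((f.u 0 hn).map (E.ρ I 1))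
    (E.imageτ f hn I 1 ≫ Pi.π (fun s => f.base.functor.obj (X (I s))) 0)
  rw [← Category.assoc, E.map_map_γ] at h1
  rw [E.G_map_ρ f hn hpc I 1 2, E.G_map_ρ f hn hpc I 0 2]
  refine h1.trans ?_
  rw [E.G_map_ρ f hn hpc I 0 1]
  have h2 : (f.u 0 hn).map (E.γ I 1 2) ≫ (f.u 0 hn).map (E.γ I 0 1) =
      T'.aut ((f.u 0 hn).obj (E.y I 2)) (res _ (E.imageτ f hn I 2) (c' I)) ≫
        (f.u 0 hn).map (E.γ I 0 2) := by
    rw [← Functor.map_comp, E.c_zero hn I (E.y_over I 2), actOn_eq, Functor.map_comp, f.map_aut,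
      BaseMap.bandMap_res, ← hc, imageτ, res_comp, res_comp]
    rfl
  exact (Category.assoc _ _ _).symm.trans
    ((congrArg (· ≫ (f.u 0 hn).map (E.ρ I 0)) h2).trans (Category.assoc _ _ _))

end AbelianTower.Choices

/-! ### Comparison of the classifying cochains -/

section Comparison

variable {C : Type u} [Category.{v} C] [HasFiniteProducts C] {J : GrothendieckTopology C}
  {L : ℕ → Sheaf J AddCommGrpCat.{w}} {n : ℕ} {ι : Type t}
  {T T' : AbelianTower.{w, v, u, v₂, u₂} J L n} {X : ι → C}

theorem AbelianTower.IsGoodCover.conn (hX : T.IsGoodCover X) (i : ι) : T.Conn (X i) := by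
  refine ⟨_, hX.connected 0 fun _ => i, ⟨Pi.lift fun _ => 𝟙 _, Pi.π _ 0, by simp, ?_⟩⟩
  apply Pi.hom_ext
  intro r
  rw [Category.assoc, Pi.lift_π, Category.comp_id, Category.id_comp, Fin.fin_one_eq_zero r]

theorem BaseMap.cochainMap_refl (j : ℕ) (k : ℕ) (c : CechCochain (L j).obj X k) :
    (BaseMap.refl J L).cochainMap j X k c = c := by
  refine (BaseMap.cochainMap_eq_iff (X := X) (BaseMap.refl J L)).2 fun I => ?_
  change res _ (piComparison (𝟭 C) fun r => X (I r)) (c I) = c I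
  rw [piComparison_id]
  exact res_id _ (c I)

theorem BaseMap.exists_cochainMap_eq (b : BaseMap J L) (hpc : ∀ (k : ℕ) (I : Fin k → ι),
      IsIso (piComparison b.functor fun r => X (I r))) (j k : ℕ) (c : CechCochain (L j).obj X k) :
    ∃ c', b.cochainMap j X k c' = c := by
  refine ⟨fun I => res _ (inv (piComparison b.functor fun r => X (I r))) (b.bandMap j _ (c I)), ?_⟩
  rw [BaseMap.cochainMap_eq_iff]
  intro I
  rw [← res_comp, IsIso.hom_inv_id, res_id]

/-- At the gerbe level, transition data are obtained from the identity morphism of the tower; at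
higher levels the cochain is a connecting cochain. -/
theorem AbelianTower.Choices.cechD_eq_zero {c : ∀ j, CechCochain (L j).obj X (j + 2)}
    (E : T.Choices X c) (hX : T.IsGoodCover X) : ∀ j, j + 2 ≤ n → cechD (L j).obj X (j + 2) (c j) = 0
  | 0, hj => by
    have hpc : ∀ (k : ℕ) (I : Fin k → ι), IsIso (piComparison (𝟭 C) fun r => X (I r)) :=
      fun k I => by
        rw [piComparison_id]
        exact IsIso.id _
    exact (E.isClassifiedBy (TowerHom.refl T) hj hpc (BaseMap.cochainMap_refl 0 2 (c 0))).cechD_eq_zero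
      hj
  | j + 1, hj => (E.isConnecting hj).cechD_eq_zero hX (E.hasObjects hj)

/-- The classifying cochains of a tower and the images of the ones of another tower under a morphism
of towers are cohomologous. -/
theorem TowerHom.exists_cechD_eq_sub (f : TowerHom T T')
    (hpc : ∀ (k : ℕ) (I : Fin k → ι), IsIso (piComparison f.base.functor fun r => X (I r)))
    {c : ∀ j, CechCochain (L j).obj X (j + 2)}
    {c' d' : ∀ j, CechCochain (L j).obj (fun i => f.base.functor.obj (X i)) (j + 2)}
    (hX : T.IsGoodCover X) (hX' : T'.IsGoodCover fun i => f.base.functor.obj (X i))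
    (E : T.Choices X c) (E' : T'.Choices (fun i => f.base.functor.obj (X i)) c')
    (hd : ∀ j, f.base.cochainMap j X (j + 2) (d' j) = c j) :
    ∀ j, j + 2 ≤ n → ∃ e, cechD (L j).obj _ (j + 1) e = c' j - d' j
  | 0, hj => by
    have hpc' : ∀ (k : ℕ) (I : Fin k → ι),
        IsIso (piComparison (𝟭 C) fun r => f.base.functor.obj (X (I r))) :=
      fun k I => by
        rw [piComparison_id fun i => f.base.functor.obj (X i)]
        exact IsIso.id _
    exact Transition.IsClassifiedBy.exists_sub_eq hj hX'.conn (E.isClassifiedBy f hj hpc (hd 0))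
      (E'.isClassifiedBy (TowerHom.refl T') hj hpc' (BaseMap.cochainMap_refl 0 2 (c' 0)))
  | j + 1, hj => by
    obtain ⟨e, he⟩ := TowerHom.exists_cechD_eq_sub f hpc hX hX' E E' hd j (by omega)
    -- By additivity `c' (j+1) - d' (j+1)` is connecting for `c' j - d' j`, a coboundary by
    -- induction.
    have h1 := (E'.isConnecting hj).sub
      (f.isConnecting hpc hX (E.hasObjects hj) (hd j) (hd (j + 1)) (E.isConnecting hj))
    rw [← he] at h1
    exact h1.exists_cechD_eq hX' (E'.hasObjects hj)

end Comparison

end TorsorTower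

end

/-! ### The comparison of the classes -/

open CategoryTheory CategoryTheory.Limits TorsorTower in
theorem proposition5 {C : Type u} [Category.{v} C] [HasFiniteProducts C]
    {J : GrothendieckTopology C} {L : ℕ → Sheaf J AddCommGrpCat.{w}} {n : ℕ}
    (T T' : AbelianTower.{w, v, u, v₂, u₂} J L n) (e : TowerIso T T') {ι : Type t} (X : ι → C)
    (c : ∀ j, CechCochain (L j).obj X (j + 2))
    (c' : ∀ j, CechCochain (L j).obj (fun i => e.hom.base.functor.obj (X i)) (j + 2))
    (hc : T.IsClassifying X c)
    (hc' : T'.IsClassifying (fun i => e.hom.base.functor.obj (X i)) c')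
    (j : ℕ) (hj : j + 2 ≤ n) :
    ∃ (h : cechD (L j).obj X (j + 2) (c j) = 0)
      (h' : cechD (L j).obj (fun i => e.hom.base.functor.obj (X i)) (j + 2) (c' j) = 0),
      e.hom.base.cechMap j X (j + 1) (cechClass (L j).obj _ (j + 1) (c' j) h') =
        cechClass (L j).obj X (j + 1) (c j) h := by
  obtain ⟨hX, ⟨E⟩⟩ := hc
  obtain ⟨hX', ⟨E'⟩⟩ := hc'
  -- The inverse morphism enters here: `u₁` is an equivalence, hence preserves the finite products
  -- `X_I`, and the comparison maps are invertible.
  have : e.hom.base.functor.IsEquivalence :=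
    (CategoryTheory.Equivalence.mk e.hom.base.functor e.inv.base.functor e.unit₁.symm
      e.counit₁).isEquivalence_functor
  have hpc : ∀ (k : ℕ) (I : Fin k → ι),
      IsIso (piComparison e.hom.base.functor fun r => X (I r)) := fun k I => inferInstance
  choose d' hd using fun j => e.hom.base.exists_cochainMap_eq hpc j (j + 2) (c j)
  obtain ⟨ε, hε⟩ := e.hom.exists_cechD_eq_sub hpc hX hX' E E' hd j hj
  refine ⟨E.cechD_eq_zero hX j hj, E'.cechD_eq_zero hX' j hj, ?_⟩
  -- Pulling `δε = c' j - d' j` back by `u₁` gives the pull-back of `c' j` minus `c j`.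
  refine (QuotientAddGroup.eq_iff_sub_mem).2 ⟨e.hom.base.cochainMap j X (j + 1) ε, ?_⟩
  rw [BaseMap.cechD_cochainMap, hε, map_sub, hd]
  rfl
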